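/- **Setting.** All Hilbert spaces are finite dimensional. A non-local game $\mathcal{G}$ consists of finite question sets $I_A, I_B$, answer sets $\{0,\dots,n_A-1\}$, $\{0,\dots,n_B-1\}$ with $n_A,n_B\ge 1$, a probability distribution $\pi$ on $I_A\times I_B$ and a predicate $V(i,j,a,b)\in\{0,1\}$. A strategy $\mathcal{S}=(\{A_i\}_{i\in I_A},\{B_j\}_{j\in I_B},|\psi\rangle)$ consists of unitaries $A_i$ on $\mathbb{C}^{d_A}$ with $A_i^{n_A}=I$, unitaries $B_j$ on $\mathbb{C}^{d_B}$ with $B_j^{n_B}=I$, and a unit vector $|\psi\rangle\in\mathbb{C}^{d_A}\otimes\mathbb{C}^{d_B}$. With the measurement projections $E_{i,a}=\frac1{n_A}\sum_{k=0}^{n_A-1}(e^{-2\pi \mathrm{i} a/n_A}A_i)^k$ and $F_{j,b}$ (defined likewise from $B_j$, $n_B$), its winning probability is $\nu(\mathcal{G},\mathcal{S})=\sum_{i,j,a,b}\pi(i,j)V(i,j,a,b)\langle\psi|E_{i,a}\otimes F_{j,b}|\psi\rangle$. The quantum value $\nu^*(\mathcal{G})$ is the supremum of $\nu(\mathcal{G},\mathcal{S})$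 over all strategies, and $\mathcal{S}$ is optimal if $\nu(\mathcal{G},\mathcal{S})=\nu^*(\mathcal{G})$. Let $G_A,G_B$ be finite groups with generators $\{P_i\}_{i\in I_A}$ and $\{Q_j\}_{j\in I_B}$. For unitary representations $\rho$ of $G_A$ and $\sigma$ of $G_B$ with $\rho(P_i)^{n_A}=I$ and $\sigma(Q_j)^{n_B}=I$ for all $i,j$, and a state $|\phi\rangle\in\mathbb{C}^{d_\rho}\otimes\mathbb{C}^{d_\sigma}$, let $\mathcal{S}_{\rho,\sigma,|\phi\rangle}=(\{\rho(P_i)\},\{\sigma(Q_j)\},|\phi\rangle)$ and $\nu(\mathcal{G},\rho,\sigma)=\max_{|\phi\rangle}\nu(\mathcal{G},\mathcal{S}_{\rho,\sigma,|\phi\rangle})$. A map $f$ from a finite group $G$ to the unitaries of one of the two tensor factors is a $|\psi\rangle$-representation if $\mathbb{E}_{x,y\in G}\,\mathrm{Re}\,\mathrm{Tr}\big((f(x)^*f(y))^*f(x^{-1}y)\,\tau\big)\ge 1$, where $\tau$ is the reduced density matrix of $|\psi\rangle$ on that factor. For a strategy $\mathcal{S}$ let $f_A^{\mathcal{S}}$,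 $f_B^{\mathcal{S}}$ be the homomorphisms from the free groups on $I_A$, $I_B$ to the unitaries on $\mathbb{C}^{d_A}$, $\mathbb{C}^{d_B}$ that send the generators to the $A_i$, $B_j$. We say that $f_A^{\mathcal{S}}$ is a $|\psi\rangle$-representation of $G_A$ if, for every choice of a word $w_x$ in the $P_i^{\pm1}$ representing each $x\in G_A$, the map $x\mapsto f_A^{\mathcal{S}}(w_x)$ is a $|\psi\rangle$-representation of $G_A$; similarly for $f_B^{\mathcal{S}}$ and $G_B$. $\mathcal{G}$ is a self-test for $\mathcal{S}=(\{A_i\},\{B_j\},|\psi\rangle)$ if $\mathcal{S}$ is optimal and there are $\epsilon_0\ge 0$ and a continuous $\delta:[0,\infty)\to[0,\infty)$ with $\delta(0)=0$ such that for all $0\le\epsilon\le\epsilon_0$ and every strategy $\tilde{\mathcal{S}}=(\{\tilde A_i\},\{\tilde B_j\},|\tilde\psi\rangle)$ with $\nu(\mathcal{G},\tilde{\mathcal{S}})\ge\nu^*(\mathcal{G})-\epsilon$ there are local isometries $V_A,V_B$ and a state $|\mathrm{junk}\rangle$ with $\|V_A\otimes V_B|\tilde\psi\rangle-|\mathrm{junk}\rangle|\psi\rangle\|\le\delta(\epsilon)$,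 $\|V_A\tilde A_i\otimes V_B|\tilde\psi\rangle-|\mathrm{junk}\rangle(A_i\otimes I)|\psi\rangle\|\le\delta(\epsilon)$ and $\|V_A\otimes V_B\tilde B_j|\tilde\psi\rangle-|\mathrm{junk}\rangle(I\otimes B_j)|\psi\rangle\|\le\delta(\epsilon)$ for all $i\in I_A$, $j\in I_B$. (Since $\epsilon_0=0$ is allowed, this asks for exact rigidity.) **Theorem.** Let $(\bar\rho,\bar\sigma)$ be unitary irreducible representations of $G_A,G_B$ with $\bar\rho(P_i)^{n_A}=I$, $\bar\sigma(Q_j)^{n_B}=I$ for all $i,j$. Suppose that, up to equivalence, $(\bar\rho,\bar\sigma)$ is the only pair of irreducible representations of this kind with $\nu(\mathcal{G},\bar\rho,\bar\sigma)=\nu^*(\mathcal{G})$, and that $|\psi\rangle$ is, up to a global phase, the only state for which $\mathcal{S}_{\bar\rho,\bar\sigma,|\psi\rangle}$ is optimal. 1. Let $\tilde{\mathcal{S}}=(\{\tilde A_i\},\{\tilde B_j\},|\tilde\psi\rangle)$, $|\tilde\psi\rangle\in\mathbb{C}^{d_A}\otimes\mathbb{C}^{d_B}$, be an optimal strategy such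 that $f_A^{\tilde{\mathcal{S}}}$ and $f_B^{\tilde{\mathcal{S}}}$ are $|\tilde\psi\rangle$-representations of $G_A$ and $G_B$. Then there are isometries $V_A:\mathbb{C}^{d_A}\to\mathbb{C}^{k_A}\otimes\mathbb{C}^{d_{\bar\rho}}\cong\mathbb{C}^{d_A|G_A|}$ and $V_B:\mathbb{C}^{d_B}\to\mathbb{C}^{k_B}\otimes\mathbb{C}^{d_{\bar\sigma}}\cong\mathbb{C}^{d_B|G_B|}$, where $k_Ad_{\bar\rho}=d_A|G_A|$ and $k_Bd_{\bar\sigma}=d_B|G_B|$, and a state $|\mathrm{junk}\rangle\in\mathbb{C}^{k_A}\otimes\mathbb{C}^{k_B}$ such that, for all $i\in I_A$, $j\in I_B$, $$V_A\otimes V_B|\tilde\psi\rangle=|\mathrm{junk}\rangle|\psi\rangle,$$ $$V_A\tilde A_i\otimes V_B|\tilde\psi\rangle=|\mathrm{junk}\rangle\,(\bar\rho(P_i)\otimes I)|\psi\rangle,\qquad V_A\otimes V_B\tilde B_j|\tilde\psi\rangle=|\mathrm{junk}\rangle\,(I\otimes\bar\sigma(Q_j))|\psi\rangle.$$ 2.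 If for every optimal strategy $\tilde{\mathcal{S}}$ the maps $f_A^{\tilde{\mathcal{S}}}$ and $f_B^{\tilde{\mathcal{S}}}$ are $|\tilde\psi\rangle$-representations of $G_A$ and $G_B$, then $\mathcal{G}$ is a self-test for $\mathcal{S}_{\bar\rho,\bar\sigma,|\psi\rangle}$. -/

import Mathlib

open scoped Matrix Kronecker NNReal

noncomputable section

/-- A non-local game with finite question sets `IA`, `IB`, answer sets `{0, …, nA - 1}` and
`{0, …, nB - 1}`, a probability distribution on the pairs of questions, and a winning predicate. -/
structure NonlocalGame (IA IB : Type*) [Fintype IA] [Fintype IB] (nA nB : ℕ) where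
  prob : IA → IB → ℝ
  prob_nonneg : ∀ i j, 0 ≤ prob i j
  prob_sum : ∑ i, ∑ j, prob i j = 1
  wins : IA → IB → Fin nA → Fin nB → Bool

/-- A (finite-dimensional) quantum strategy, in terms of generalized observables of orders `nA` and
`nB`, on the bipartite space `ℂ^dA ⊗ ℂ^dB`, whose vectors are indexed by `Fin dA × Fin dB`. -/
structure QStrategy (IA IB : Type*) (nA nB dA dB : ℕ) where
  A : IA → Matrix.unitaryGroup (Fin dA) ℂ
  B : IB → Matrix.unitaryGroup (Fin dB) ℂ
  A_pow : ∀ i, A i ^ nA = 1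
  B_pow : ∀ j, B j ^ nB = 1
  ψ : EuclideanSpace ℂ (Fin dA × Fin dB)
  norm_ψ : ‖ψ‖ = 1

/-- The projection for outcome `a` of an order-`n` generalized observable `U`:
`E_a = (1/n) ∑_{k < n} (ω⁻ᵃ U)ᵏ` with `ω = exp(2πi/n)`; so `U = ∑ₐ ωᵃ E_a`. -/
def observableProj {d : ℕ} (n : ℕ) (U : Matrix (Fin d) (Fin d) ℂ) (a : Fin n) :
    Matrix (Fin d) (Fin d) ℂ :=
  (1 / (n : ℂ)) • ∑ k ∈ Finset.range n,
    ((Complex.exp (2 * Real.pi * Complex.I / n))⁻¹ ^ (a : ℕ) • U) ^ k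

section Values

variable {IA IB : Type*} [Fintype IA] [Fintype IB] {nA nB : ℕ}

/-- The winning probability `∑ π(i,j) V(i,j,a,b) ⟨ψ| E_{i,a} ⊗ F_{j,b} |ψ⟩` of a strategy. -/
def NonlocalGame.value (𝒢 : NonlocalGame IA IB nA nB) {dA dB : ℕ}
    (S : QStrategy IA IB nA nB dA dB) : ℝ :=
  ∑ i, ∑ j, ∑ a, ∑ b, 𝒢.prob i j *
    (inner ℂ S.ψ (Matrix.toEuclideanLin
      (observableProj nA (S.A i : Matrix (Fin dA) (Fin dA) ℂ) a ⊗ₖ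
        observableProj nB (S.B j : Matrix (Fin dB) (Fin dB) ℂ) b) S.ψ)).re *
    (if 𝒢.wins i j a b then 1 else 0)

/-- The quantum value: supremum of the winning probability over all quantum strategies. -/
def NonlocalGame.quantumValue (𝒢 : NonlocalGame IA IB nA nB) : ℝ :=
  sSup {p : ℝ | ∃ (dA dB : ℕ) (S : QStrategy IA IB nA nB dA dB), p = 𝒢.value S}

/-- A strategy is optimal if it attains the quantum value. -/
def NonlocalGame.IsOptimal (𝒢 : NonlocalGame IA IB nA nB) {dA dB : ℕ}
    (S : QStrategy IA IB nA nB dA dB) : Prop :=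
  𝒢.value S = 𝒢.quantumValue

end Values

/-- The vector `|χ⟩|ψ⟩`, for bipartite `χ ∈ ℂ^kA ⊗ ℂ^kB` and `ψ ∈ ℂ^dA ⊗ ℂ^dB`, as an element of
the bipartite space `(ℂ^kA ⊗ ℂ^dA) ⊗ (ℂ^kB ⊗ ℂ^dB)`. -/
def bipartiteTensor {kA kB dA dB : ℕ} (χ : EuclideanSpace ℂ (Fin kA × Fin kB))
    (ψ : EuclideanSpace ℂ (Fin dA × Fin dB)) :
    EuclideanSpace ℂ ((Fin kA × Fin dA) × (Fin kB × Fin dB)) :=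
  WithLp.toLp 2 fun p => χ (p.1.1, p.2.1) * ψ (p.1.2, p.2.2)

section SelfTest

variable {IA IB : Type*} [Fintype IA] [Fintype IB] {nA nB : ℕ}

/-- The game `𝒢` is a self-test for the strategy `S`: `S` is optimal, and for some `ε₀ ≥ 0` and some
continuous `δ : ℝ₊ → ℝ₊` with `δ 0 = 0`, every strategy that is `ε`-close to optimal with `ε ≤ ε₀`
is `δ ε`-close to `S`, up to local isometries `VA`, `VB` and a junk state. -/
def NonlocalGame.IsSelfTest (𝒢 : NonlocalGame IA IB nA nB) {dA dB : ℕ}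
    (S : QStrategy IA IB nA nB dA dB) : Prop :=
  𝒢.IsOptimal S ∧
  ∃ (ε₀ : ℝ≥0) (δ : ℝ≥0 → ℝ≥0), Continuous δ ∧ δ 0 = 0 ∧
    ∀ ε : ℝ≥0, ε ≤ ε₀ → ∀ (eA eB : ℕ) (T : QStrategy IA IB nA nB eA eB),
      𝒢.quantumValue - ε ≤ 𝒢.value T →
      ∃ (kA kB : ℕ) (VA : Matrix (Fin kA × Fin dA) (Fin eA) ℂ)
        (VB : Matrix (Fin kB × Fin dB) (Fin eB) ℂ)
        (junk : EuclideanSpace ℂ (Fin kA × Fin kB)),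
        VAᴴ * VA = 1 ∧ VBᴴ * VB = 1 ∧ ‖junk‖ = 1 ∧
        ‖Matrix.toEuclideanLin (VA ⊗ₖ VB) T.ψ - bipartiteTensor junk S.ψ‖ ≤ δ ε ∧
        (∀ i, ‖Matrix.toEuclideanLin ((VA * (T.A i : Matrix (Fin eA) (Fin eA) ℂ)) ⊗ₖ VB) T.ψ -
          bipartiteTensor junk (Matrix.toEuclideanLin
            ((S.A i : Matrix (Fin dA) (Fin dA) ℂ) ⊗ₖ (1 : Matrix (Fin dB) (Fin dB) ℂ)) S.ψ)‖
          ≤ δ ε) ∧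
        (∀ j, ‖Matrix.toEuclideanLin (VA ⊗ₖ (VB * (T.B j : Matrix (Fin eB) (Fin eB) ℂ))) T.ψ -
          bipartiteTensor junk (Matrix.toEuclideanLin
            ((1 : Matrix (Fin dA) (Fin dA) ℂ) ⊗ₖ (S.B j : Matrix (Fin dB) (Fin dB) ℂ)) S.ψ)‖
          ≤ δ ε)

end SelfTest

/-- Reduced density matrix of `ψ` on the first factor. -/
def reducedA {dA dB : ℕ} (ψ : EuclideanSpace ℂ (Fin dA × Fin dB)) : Matrix (Fin dA) (Fin dA) ℂ :=
  Matrix.of fun a a' => ∑ b, ψ (a, b) * star (ψ (a', b))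

/-- Reduced density matrix of `ψ` on the second factor. -/
def reducedB {dA dB : ℕ} (ψ : EuclideanSpace ℂ (Fin dA × Fin dB)) : Matrix (Fin dB) (Fin dB) ℂ :=
  Matrix.of fun b b' => ∑ a, ψ (a, b) * star (ψ (a, b'))

section Reps

variable {G : Type*} [Group G]

/-- `f : G → U_d(ℂ)` is an `(ε, |ψ⟩)`-representation, where `τ` is the reduced density matrix of `ψ`
on the space on which `f` acts: `𝔼_{x,y} Re ⟨f(x)* f(y), f(x⁻¹y)⟩_τ ≥ 1 - ε`,
with `⟨X, Y⟩_τ = Tr(X* Y τ)`. -/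
def IsApproxStateRep [Fintype G] {d : ℕ} (ε : ℝ) (τ : Matrix (Fin d) (Fin d) ℂ)
    (f : G → Matrix.unitaryGroup (Fin d) ℂ) : Prop :=
  1 - ε ≤ (1 / (Fintype.card G : ℝ) ^ 2) * ∑ x, ∑ y,
    (((f x : Matrix (Fin d) (Fin d) ℂ)ᴴ * (f y : Matrix (Fin d) (Fin d) ℂ))ᴴ *
      (f (x⁻¹ * y) : Matrix (Fin d) (Fin d) ℂ) * τ).trace.re

/-- Let `P : I → G` be generators of `G` and let `A : I → U_d(ℂ)`. The homomorphism from the free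
group on `I` to `U_d(ℂ)` with `i ↦ A i` is a `|ψ⟩`-representation of `G`: whatever word `s x` is
chosen to represent each `x : G`, evaluating the words at `A` gives a `|ψ⟩`-representation of `G`
(`τ` is the reduced density matrix of `ψ`). -/
def InducesStateRep [Fintype G] {I : Type*} {d : ℕ} (P : I → G)
    (A : I → Matrix.unitaryGroup (Fin d) ℂ) (τ : Matrix (Fin d) (Fin d) ℂ) : Prop :=
  ∀ s : G → FreeGroup I, (∀ x, FreeGroup.lift P (s x) = x) →
    IsApproxStateRep 0 τ fun x => FreeGroup.lift A (s x)

/-- A unitary matrix representation as a representation on `ℂ^d`. -/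
def matRep {d : ℕ} (ρ : G →* Matrix.unitaryGroup (Fin d) ℂ) : Representation ℂ G (Fin d → ℂ) where
  toFun g := Matrix.toLin' (ρ g : Matrix (Fin d) (Fin d) ℂ)
  map_one' := by simp; rfl
  map_mul' g h := by simp [Matrix.toLin'_mul]; rfl

/-- `ρ` maps the elements `P i` to order-`n` generalized observables. -/
def GivesObservables {I : Type*} {d : ℕ} (n : ℕ) (P : I → G)
    (ρ : G →* Matrix.unitaryGroup (Fin d) ℂ) : Prop :=
  ∀ i, ρ (P i) ^ n = 1

end Reps

section RepStrategy

variable {IA IB : Type*} {nA nB : ℕ} {GA GB : Type*} [Group GA] [Group GB]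
  {P : IA → GA} {Q : IB → GB} {dA dB : ℕ}
  {ρ : GA →* Matrix.unitaryGroup (Fin dA) ℂ} {σ : GB →* Matrix.unitaryGroup (Fin dB) ℂ}

/-- The strategy `({ρ(P i)}, {σ(Q j)}, |ψ⟩)` induced by a pair of representations and a state. -/
def repStrategy (hρ : GivesObservables nA P ρ) (hσ : GivesObservables nB Q σ)
    (ψ : EuclideanSpace ℂ (Fin dA × Fin dB)) (hψ : ‖ψ‖ = 1) : QStrategy IA IB nA nB dA dB where
  A i := ρ (P i)
  B j := σ (Q j)
  A_pow := hρ
  B_pow := hσ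
  ψ := ψ
  norm_ψ := hψ

/-- `ν(𝒢, ρ, σ)`: the best winning probability, over all states, of the strategies induced
by `(ρ, σ)`. -/
def NonlocalGame.repValue [Fintype IA] [Fintype IB] (𝒢 : NonlocalGame IA IB nA nB)
    (hρ : GivesObservables nA P ρ) (hσ : GivesObservables nB Q σ) : ℝ :=
  ⨆ ψ : {ψ : EuclideanSpace ℂ (Fin dA × Fin dB) // ‖ψ‖ = 1},
    𝒢.value (repStrategy hρ hσ ψ.1 ψ.2)

end RepStrategy

end

/-! The observables of an optimal strategy are viewed as unitary representations of the free groups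
on the questions, rather than of `GA` and `GB`, so that they split exactly into irreducible blocks
(`nonempty_irreducibleDecomposition`). The blocks of both parties cut the state into components, and
the winning form is block diagonal with respect to them. A component wins at most the quantum value
times its squared norm, and these bounds add up to the quantum value, so every component is optimal
(`NonlocalGame.winForm_component_eq`).

The state-representation condition says that an average of numbers at most 1 is at least 1, so each
of them equals 1. Since the choice of words is free, any word in the kernel of the map to the finite
group may represent the identity, and its term says that it fixes the state
(`InducesStateRep.map_eq_of_lift_eq_one`). In an irreducible block the vectors fixed by this kernel
form an invariant subspace, so a block that carries a nonzero component factors through the finite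
group (`exists_descent`). The uniqueness hypotheses then identify the block with `ρbar` or `σbar`,
and the component with a multiple of `ψ` (`NonlocalGame.exists_blocks`).

The coefficients of these multiples form the junk state. The copies of `ρbar` in question span a
space `ℂ^κ ⊗ ℂ^dρ`, whose embedding into `ℂ^kA ⊗ ℂ^dρ` extends to the required isometry; the
prescribed `kA` is an integer because the dimension of an irreducible representation divides the
order of the group (`dim_dvd_card`). The second claim follows from the first with `ε₀ = 0` and `δ =
0`. -/

section MatRep

/-! ### Unitary matrix representations: Schur's lemma, divisibility, unitary equivalence. -/

variable {G : Type*} [Group G] {d : ℕ}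

theorem unitary_conjTranspose_mul_self (U : Matrix.unitaryGroup (Fin d) ℂ) :
    (U : Matrix (Fin d) (Fin d) ℂ)ᴴ * (U : Matrix (Fin d) (Fin d) ℂ) = 1 :=
  Matrix.mem_unitaryGroup_iff'.1 U.2

theorem conjTranspose_coe_map (ρ : G →* Matrix.unitaryGroup (Fin d) ℂ) (g : G) :
    (ρ g : Matrix (Fin d) (Fin d) ℂ)ᴴ = (ρ g⁻¹ : Matrix (Fin d) (Fin d) ℂ) := by
  rw [map_inv]; rfl

/-- A representation on `ℂ^0` is not irreducible. -/
theorem dim_pos_of_isIrreducible {ρ : G →* Matrix.unitaryGroup (Fin d) ℂ}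
    (h : (matRep ρ).IsIrreducible) : 0 < d := by
  rcases Nat.eq_zero_or_pos d with rfl | hd
  · exfalso
    obtain ⟨x, y, hxy⟩ := h.toNontrivial
    apply hxy
    apply Subrepresentation.toSubmodule_injective
    exact Subsingleton.elim _ _
  · exact hd

/-- Schur's lemma. -/
theorem exists_eq_smul_one_of_commute {ρ : G →* Matrix.unitaryGroup (Fin d) ℂ}
    (h : (matRep ρ).IsIrreducible) (M : Matrix (Fin d) (Fin d) ℂ)
    (hM : ∀ g, M * (ρ g : Matrix (Fin d) (Fin d) ℂ) = (ρ g : Matrix (Fin d) (Fin d) ℂ) * M) :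
    ∃ c : ℂ, M = c • 1 := by
  let f : Representation.IntertwiningMap (matRep ρ) (matRep ρ) :=
    ⟨Matrix.toLin' M, fun g => by
      have := congrArg Matrix.toLin' (hM g)
      rwa [Matrix.toLin'_mul, Matrix.toLin'_mul] at this⟩
  obtain ⟨c, hc⟩ :=
    (Representation.IsIrreducible.algebraMap_intertwiningMap_bijective_of_isAlgClosed
      (k := ℂ) (ρ := matRep ρ)).2 f
  refine ⟨c, Matrix.toLin'.injective (LinearMap.ext fun v => ?_)⟩
  have h1 : f v = c • v := by rw [← hc]; rfl
  have h2 : f v = Matrix.toLin' M v := rfl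
  rw [← h2, h1]
  simp

/-- Averaging a matrix over an irreducible representation gives a scalar. -/
theorem sum_mul_mul_inv_eq [Fintype G] {ρ : G →* Matrix.unitaryGroup (Fin d) ℂ}
    (h : (matRep ρ).IsIrreducible) (X : Matrix (Fin d) (Fin d) ℂ) :
    ∑ g, (ρ g : Matrix (Fin d) (Fin d) ℂ) * X * (ρ g⁻¹ : Matrix (Fin d) (Fin d) ℂ) =
      ((Fintype.card G : ℂ) * X.trace / d) • 1 := by
  have hd := dim_pos_of_isIrreducible h
  obtain ⟨c, hc⟩ := exists_eq_smul_one_of_commute h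
    (∑ g, (ρ g : Matrix (Fin d) (Fin d) ℂ) * X * (ρ g⁻¹ : Matrix (Fin d) (Fin d) ℂ)) (by
      intro k
      rw [Finset.sum_mul, Finset.mul_sum, ← Equiv.sum_comp (Equiv.mulLeft k)]
      refine Finset.sum_congr rfl fun g _ => ?_
      simp only [Equiv.coe_mulLeft, mul_inv_rev, map_mul, Submonoid.coe_mul, mul_assoc]
      rw [← Submonoid.coe_mul (Matrix.unitaryGroup (Fin d) ℂ) (ρ k⁻¹) (ρ k), ← map_mul]
      simp)
  have ht := congrArg Matrix.trace hc
  rw [Matrix.trace_sum, Matrix.trace_smul, Matrix.trace_one] at ht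
  have : ∀ g ∈ (Finset.univ : Finset G), ((ρ g : Matrix (Fin d) (Fin d) ℂ) * X *
      (ρ g⁻¹ : Matrix (Fin d) (Fin d) ℂ)).trace = X.trace := by
    intro g _
    rw [Matrix.trace_mul_comm, ← mul_assoc, ← Submonoid.coe_mul, ← map_mul]
    simp
  rw [Finset.sum_congr rfl this] at ht
  simp only [Finset.sum_const, Finset.card_univ, nsmul_eq_mul, Fintype.card_fin,
    smul_eq_mul] at ht
  rw [hc, ht, mul_div_assoc, div_self (by exact_mod_cast hd.ne'), mul_one]

/-- Averaging the matrix units `E_{jk}` gives the orthogonality relations, which are summed here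
over the diagonal. The scalar on the right is the one that `dim_dvd_card` shows to be an integer. -/
theorem sum_trace_inv_smul_eq [Fintype G] {ρ : G →* Matrix.unitaryGroup (Fin d) ℂ}
    (h : (matRep ρ).IsIrreducible) :
    ∑ g, (ρ g⁻¹ : Matrix (Fin d) (Fin d) ℂ).trace • (ρ g : Matrix (Fin d) (Fin d) ℂ) =
      ((Fintype.card G : ℂ) / d) • 1 := by
  ext i j
  have key : ∀ k, ∑ g, (ρ g : Matrix (Fin d) (Fin d) ℂ) i j *
      (ρ g⁻¹ : Matrix (Fin d) (Fin d) ℂ) k k =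
      if j = k ∧ i = k then (Fintype.card G : ℂ) / d else 0 := by
    intro k
    have := congrFun (congrFun (sum_mul_mul_inv_eq h (Matrix.single j k 1)) i) k
    rw [Matrix.sum_apply] at this
    simp only [Matrix.mul_apply, Matrix.single_apply, Matrix.smul_apply, Matrix.one_apply,
      ite_and, mul_ite, mul_one, mul_zero, ite_mul, zero_mul, Finset.sum_ite_eq,
      Finset.mem_univ, if_true] at this
    rw [this]
    by_cases hjk : j = k <;> by_cases hik : i = k <;> simp [hjk, hik, Matrix.trace_single_eq_of_ne]
  simp only [Matrix.sum_apply, Matrix.smul_apply, Matrix.trace, Matrix.diag_apply, smul_eq_mul,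
    Finset.sum_mul]
  rw [Finset.sum_comm]
  have hcomm : ∀ k g, (ρ g⁻¹ : Matrix (Fin d) (Fin d) ℂ) k k *
      (ρ g : Matrix (Fin d) (Fin d) ℂ) i j = (ρ g : Matrix (Fin d) (Fin d) ℂ) i j *
      (ρ g⁻¹ : Matrix (Fin d) (Fin d) ℂ) k k := fun k g => mul_comm _ _
  simp only [hcomm, key, ite_and, Finset.sum_ite_eq, Finset.mem_univ, if_true, Matrix.one_apply]
  simp

/-- The trace is the sum of the eigenvalues, which are roots of unity. -/
theorem isIntegral_trace_of_pow_eq_one {A : Matrix (Fin d) (Fin d) ℂ} {n : ℕ} (hn : 0 < n)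
    (h : A ^ n = 1) : IsIntegral ℤ A.trace := by
  rw [Matrix.trace_eq_sum_roots_charpoly]
  refine IsIntegral.multiset_sum fun μ hμ => ?_
  have hμ' := (Polynomial.mem_roots'.1 hμ).2
  rw [← Matrix.mem_spectrum_iff_isRoot_charpoly] at hμ'
  have := spectrum.pow_mem_pow A n hμ'
  rw [h] at this
  refine IsIntegral.of_pow hn ?_
  have hne : Nontrivial (Matrix (Fin d) (Fin d) ℂ) := by
    by_contra hne
    rw [not_nontrivial_iff_subsingleton] at hne
    simp [spectrum.of_subsingleton] at this
  rw [spectrum.one_eq] at this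
  rw [Set.mem_singleton_iff.1 this]
  exact isIntegral_one

/-- The dimension of an irreducible representation divides the order of the group. -/
theorem dim_dvd_card [Fintype G] {ρ : G →* Matrix.unitaryGroup (Fin d) ℂ}
    (h : (matRep ρ).IsIrreducible) : d ∣ Fintype.card G := by
  have hd := dim_pos_of_isIrreducible h
  let χ : G → ℂ := fun g => (ρ g : Matrix (Fin d) (Fin d) ℂ).trace
  have hχ : ∀ g, χ g ∈ integralClosure ℤ ℂ := fun g =>
    isIntegral_trace_of_pow_eq_one (n := Fintype.card G) Fintype.card_pos (by
      rw [← SubmonoidClass.coe_pow, ← map_pow, pow_card_eq_one, map_one]; rfl)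
  let c : ℂ := (Fintype.card G : ℂ) / d
  -- Multiply `sum_trace_inv_smul_eq` by `ρ x` and take traces.
  have hconv : ∀ x, c * χ x = ∑ g, χ g⁻¹ * χ (g * x) := by
    intro x
    have := congrArg (fun M => (M * (ρ x : Matrix (Fin d) (Fin d) ℂ)).trace)
      (sum_trace_inv_smul_eq h)
    simp only [Finset.sum_mul, Matrix.trace_sum, Matrix.smul_mul, Matrix.trace_smul, one_mul,
      smul_eq_mul] at this
    simp only [χ, c, ← this, map_mul, Submonoid.coe_mul]
  -- The translates of the character span a finitely generated nonzero module over the algebraic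
  -- integers. By `hconv` it is stable under multiplication by `c`, so `c` is integral; being
  -- rational, it is an integer.
  let N : Submodule (integralClosure ℤ ℂ) (G → ℂ) :=
    Submodule.span _ (Set.range fun x : G => fun y => χ (x * y))
  have hint : IsIntegral (integralClosure ℤ ℂ) c := by
    refine isIntegral_of_smul_mem_submodule N ?_ (Submodule.fg_span (Set.finite_range _)) c ?_
    · intro hN
      have h1 : (fun y => χ (1 * y)) ∈ N := Submodule.subset_span ⟨1, rfl⟩
      rw [hN, Submodule.mem_bot] at h1
      have := congrFun h1 1
      simp [χ, hd.ne'] at this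
    · intro n hn
      induction hn using Submodule.span_induction with
      | mem f hf =>
        obtain ⟨x, rfl⟩ := hf
        have : (c • fun y => χ (x * y)) =
            ∑ g, (⟨χ g⁻¹, hχ _⟩ : integralClosure ℤ ℂ) • fun y => χ (g * x * y) := by
          ext y
          rw [Finset.sum_apply]
          simp only [Pi.smul_apply, smul_eq_mul, hconv, Subalgebra.smul_def, mul_assoc]
        rw [this]
        exact Submodule.sum_mem _ fun g _ =>
          Submodule.smul_mem _ _ (Submodule.subset_span ⟨g * x, rfl⟩)
      | zero => simp
      | add x y _ _ hx hy => rw [smul_add]; exact N.add_mem hx hy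
      | smul a x _ hx => rw [smul_comm]; exact N.smul_mem _ hx
  have hint' : IsIntegral ℤ c := isIntegral_trans c hint
  have hq : c = algebraMap ℚ ℂ ((Fintype.card G : ℚ) / d) := by simp [c]
  rw [hq, isIntegral_algebraMap_iff (algebraMap ℚ ℂ).injective] at hint'
  obtain ⟨z, hz⟩ := IsIntegrallyClosed.isIntegral_iff.1 hint'
  have hz' : (z : ℚ) * d = Fintype.card G := by
    have : (z : ℚ) = (Fintype.card G : ℚ) / d := by simpa using hz
    rw [this, div_mul_cancel₀ _ (by exact_mod_cast hd.ne')]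
  have : (d : ℤ) ∣ (Fintype.card G : ℤ) := ⟨z, by
    have : z * (d : ℤ) = (Fintype.card G : ℤ) := by exact_mod_cast hz'
    rw [← this, mul_comm]⟩
  exact_mod_cast this

/-- Equivalent irreducible unitary representations are unitarily equivalent. -/
theorem exists_unitary_intertwiner {e : ℕ} {ρ : G →* Matrix.unitaryGroup (Fin d) ℂ}
    {σ : G →* Matrix.unitaryGroup (Fin e) ℂ} (hσ : (matRep σ).IsIrreducible)
    (f : (matRep ρ).Equiv (matRep σ)) :
    ∃ U : Matrix (Fin d) (Fin e) ℂ, Uᴴ * U = 1 ∧ U * Uᴴ = 1 ∧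
      ∀ g, (ρ g : Matrix (Fin d) (Fin d) ℂ) * U = U * (σ g : Matrix (Fin e) (Fin e) ℂ) := by
  let T : Matrix (Fin d) (Fin e) ℂ := LinearMap.toMatrix' f.symm.toLinearEquiv.toLinearMap
  let S : Matrix (Fin e) (Fin d) ℂ := LinearMap.toMatrix' f.toLinearEquiv.toLinearMap
  have hTS : T * S = 1 := by
    rw [← LinearMap.toMatrix'_comp, ← LinearMap.toMatrix'_id]
    congr 1
    refine LinearMap.ext fun v => ?_
    exact f.toLinearEquiv.symm_apply_apply _
  have hST : S * T = 1 := by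
    rw [← LinearMap.toMatrix'_comp, ← LinearMap.toMatrix'_id]
    congr 1
    refine LinearMap.ext fun v => ?_
    exact f.toLinearEquiv.apply_symm_apply _
  have hT : ∀ g, (ρ g : Matrix (Fin d) (Fin d) ℂ) * T = T * (σ g : Matrix (Fin e) (Fin e) ℂ) := by
    intro g
    apply Matrix.toLin'.injective
    rw [Matrix.toLin'_mul, Matrix.toLin'_mul, Matrix.toLin'_toMatrix']
    exact (f.symm.isIntertwining' g).symm
  have hT' : ∀ g, (σ g : Matrix (Fin e) (Fin e) ℂ) * Tᴴ = Tᴴ * (ρ g : Matrix (Fin d) (Fin d) ℂ) := by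
    intro g
    have := congrArg Matrix.conjTranspose (hT g⁻¹)
    simp only [Matrix.conjTranspose_mul, conjTranspose_coe_map, inv_inv] at this
    exact this.symm
  -- By unitarity `Tᴴ` intertwines in the opposite direction, so `Tᴴ * T` is a scalar `c` by Schur's
  -- lemma, and `T / √c` will be unitary.
  obtain ⟨c, hc⟩ := exists_eq_smul_one_of_commute hσ (Tᴴ * T) (fun g => by
    rw [Matrix.mul_assoc, ← hT, ← Matrix.mul_assoc, ← hT', Matrix.mul_assoc])
  have he := dim_pos_of_isIrreducible hσ
  -- A diagonal entry of `Tᴴ * T`, which shows that `c` is real and nonnegative.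
  let r : ℝ := ∑ k, Complex.normSq (T k ⟨0, he⟩)
  have hcr : c = (r : ℂ) := by
    have := congrFun (congrFun hc ⟨0, he⟩) ⟨0, he⟩
    simp only [Matrix.mul_apply, Matrix.conjTranspose_apply, Matrix.smul_apply, Matrix.one_apply_eq,
      smul_eq_mul, mul_one] at this
    rw [← this, Complex.ofReal_sum]
    exact Finset.sum_congr rfl fun k _ => by rw [Complex.normSq_eq_conj_mul_self]; rfl
  have hTc : Tᴴ = c • S := by
    rw [← Matrix.mul_one Tᴴ, ← hTS, ← Matrix.mul_assoc, hc, Matrix.smul_mul, Matrix.one_mul]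
  have hr : 0 < r := by
    refine lt_of_le_of_ne (Finset.sum_nonneg fun k _ => Complex.normSq_nonneg _) fun h0 => ?_
    have hT0 : T = 0 := by
      rw [hcr, ← h0, Complex.ofReal_zero, zero_smul] at hTc
      exact Matrix.conjTranspose_eq_zero.1 hTc
    have := congrFun (congrFun hST ⟨0, he⟩) ⟨0, he⟩
    simp [hT0] at this
  have hs : (((Real.sqrt r)⁻¹ : ℝ) : ℂ) * (((Real.sqrt r)⁻¹ : ℝ) : ℂ) * c = 1 := by
    rw [hcr, ← Complex.ofReal_mul, ← Complex.ofReal_mul, ← mul_inv, Real.mul_self_sqrt hr.le,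
      inv_mul_cancel₀ hr.ne', Complex.ofReal_one]
  refine ⟨(((Real.sqrt r)⁻¹ : ℝ) : ℂ) • T, ?_, ?_, fun g => ?_⟩
  · rw [Matrix.conjTranspose_smul, Matrix.smul_mul, Matrix.mul_smul, hc, smul_smul, smul_smul,
      Complex.star_def, Complex.conj_ofReal, hs, one_smul]
  · rw [Matrix.conjTranspose_smul, Matrix.smul_mul, Matrix.mul_smul, hTc, Matrix.mul_smul, hTS,
      smul_smul, smul_smul, Complex.star_def, Complex.conj_ofReal, hs, one_smul]
  · rw [Matrix.mul_smul, Matrix.smul_mul, hT]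

end MatRep

/-! ### Isometries, their complements and their extensions. -/

section Isometries

variable {Y : Type*} [Fintype Y]

/-- The matrix whose columns are an orthonormal basis of a subspace. -/
theorem exists_isometry_onto_submodule (W : Submodule ℂ (EuclideanSpace ℂ Y)) :
    ∃ (a : ℕ) (p : Matrix Y (Fin a) ℂ), pᴴ * p = 1 ∧
      (∀ x, WithLp.toLp 2 (p *ᵥ x) ∈ W) ∧
      (∀ v ∈ W, (p * pᴴ) *ᵥ WithLp.ofLp v = WithLp.ofLp v) ∧
      (∀ v ∈ Wᗮ, pᴴ *ᵥ WithLp.ofLp v = 0) := by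
  let b := stdOrthonormalBasis ℂ W
  let p : Matrix Y (Fin (Module.finrank ℂ W)) ℂ := Matrix.of fun i j => (b j : EuclideanSpace ℂ Y) i
  have hp : ∀ x, WithLp.toLp 2 (p *ᵥ x) = ∑ j, x j • (b j : EuclideanSpace ℂ Y) := by
    intro x
    ext i
    simp [p, Matrix.mulVec, dotProduct, mul_comm]
  have hp' : ∀ (v : EuclideanSpace ℂ Y) j, (pᴴ *ᵥ WithLp.ofLp v) j =
      inner ℂ (b j : EuclideanSpace ℂ Y) v := by
    intro v j
    simp [p, Matrix.mulVec, dotProduct, PiLp.inner_apply, mul_comm]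
  refine ⟨_, p, ?_, ?_, ?_, ?_⟩
  · ext i j
    have h1 := orthonormal_iff_ite.1 b.orthonormal i j
    rw [Submodule.coe_inner] at h1
    rw [Matrix.one_apply, ← h1, ← hp']
    rfl
  · intro x
    rw [hp]
    exact Submodule.sum_mem _ fun j _ => W.smul_mem _ (b j).2
  · intro v hv
    have h1 := congrArg (Subtype.val) (b.sum_repr' ⟨v, hv⟩)
    rw [← Matrix.mulVec_mulVec]
    have h2 := hp (pᴴ *ᵥ WithLp.ofLp v)
    simp only [hp'] at h2
    rw [← WithLp.ofLp_toLp 2 (p *ᵥ (pᴴ *ᵥ WithLp.ofLp v)), h2]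
    congr 1
    simpa [Submodule.coe_inner] using h1
  · intro v hv
    ext j
    rw [hp']
    exact (Submodule.mem_orthogonal W v).1 hv _ (b j).2

variable [DecidableEq Y]

/-- The columns of `q` are an orthonormal basis of the orthogonal complement of the range of `u`, so
`u * uᴴ` and `q * qᴴ` are complementary projections. -/
theorem exists_complement_isometry {X : Type*} [Fintype X] [DecidableEq X] (u : Matrix Y X ℂ)
    (hu : uᴴ * u = 1) :
    ∃ (a : ℕ) (q : Matrix Y (Fin a) ℂ), qᴴ * q = 1 ∧ u * uᴴ + q * qᴴ = 1 := by
  let K := LinearMap.range (Matrix.toEuclideanLin u)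
  obtain ⟨a, q, hq, -, hq2, hq3⟩ := exists_isometry_onto_submodule Kᗮ
  refine ⟨a, q, hq, ?_⟩
  apply Matrix.toLin'.injective
  refine LinearMap.ext fun v => ?_
  have h1 : qᴴ *ᵥ (u *ᵥ (uᴴ *ᵥ v)) = 0 := by
    refine hq3 (WithLp.toLp 2 (u *ᵥ (uᴴ *ᵥ v))) ?_
    rw [Submodule.orthogonal_orthogonal]
    exact ⟨WithLp.toLp 2 (uᴴ *ᵥ v), rfl⟩
  have h2 : (q * qᴴ) *ᵥ (v - u *ᵥ (uᴴ *ᵥ v)) = v - u *ᵥ (uᴴ *ᵥ v) := by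
    refine hq2 (WithLp.toLp 2 (v - u *ᵥ (uᴴ *ᵥ v))) ?_
    rw [Submodule.mem_orthogonal]
    rintro _ ⟨x, rfl⟩
    have h3 : uᴴ *ᵥ (v - u *ᵥ (uᴴ *ᵥ v)) = 0 := by
      rw [Matrix.mulVec_sub, Matrix.mulVec_mulVec, hu, Matrix.one_mulVec, sub_self]
    rw [EuclideanSpace.inner_eq_star_dotProduct, dotProduct_comm]
    change star (u *ᵥ WithLp.ofLp x) ⬝ᵥ (v - u *ᵥ (uᴴ *ᵥ v)) = 0
    rw [Matrix.star_mulVec, ← Matrix.dotProduct_mulVec, h3, dotProduct_zero]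
  have h4 : (q * qᴴ) *ᵥ (u *ᵥ (uᴴ *ᵥ v)) = 0 := by
    rw [← Matrix.mulVec_mulVec, h1, Matrix.mulVec_zero]
  rw [Matrix.mulVec_sub, h4, sub_zero] at h2
  simp only [Matrix.toLin'_apply, Matrix.add_mulVec, h2, Matrix.one_mulVec]
  rw [← Matrix.mulVec_mulVec, add_sub_cancel]

theorem conjTranspose_mul_eq_zero_of_complement {X Z : Type*} [Fintype X] [DecidableEq X]
    [Fintype Z] [DecidableEq Z] {u : Matrix Y X ℂ} {q : Matrix Y Z ℂ} (hu : uᴴ * u = 1)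
    (hq : qᴴ * q = 1) (h : u * uᴴ + q * qᴴ = 1) : uᴴ * q = 0 := by
  have h1 : uᴴ * (u * uᴴ + q * qᴴ) * q = uᴴ * q := by rw [h, Matrix.mul_one]
  rw [Matrix.mul_add, ← Matrix.mul_assoc, hu, Matrix.one_mul, Matrix.add_mul, Matrix.mul_assoc,
    Matrix.mul_assoc, hq, Matrix.mul_one, add_eq_left] at h1
  exact h1

/-- A dimension count: the trace of the projection `u * uᴴ` is that of `uᴴ * u = 1`. -/
theorem trace_complement_isometry {X : Type*} [Fintype X] [DecidableEq X] {a : ℕ}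
    {u : Matrix Y X ℂ} {q : Matrix Y (Fin a) ℂ} (hu : uᴴ * u = 1)
    (hq : qᴴ * q = 1) (h : u * uᴴ + q * qᴴ = 1) : Fintype.card X + a = Fintype.card Y := by
  have := congrArg Matrix.trace h
  rw [Matrix.trace_add, Matrix.trace_mul_comm, hu, Matrix.trace_mul_comm, hq] at this
  simp only [Matrix.trace_one, Fintype.card_fin] at this
  exact_mod_cast this

/-- An isometry defined on a subspace extends to any space which is not too large. -/
theorem exists_isometry_extension {X Z : Type*} [Fintype X] [DecidableEq X] [Fintype Z]
    [DecidableEq Z] (u : Matrix Y X ℂ) (w : Matrix Z X ℂ) (hu : uᴴ * u = 1) (hw : wᴴ * w = 1)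
    (hc : Fintype.card Y ≤ Fintype.card Z) :
    ∃ V : Matrix Z Y ℂ, Vᴴ * V = 1 ∧ V * u = w := by
  obtain ⟨a, q, hq, hq'⟩ := exists_complement_isometry u hu
  obtain ⟨b, s, hs, hs'⟩ := exists_complement_isometry w hw
  have ha := trace_complement_isometry hu hq hq'
  have hb := trace_complement_isometry hw hs hs'
  have hab : a ≤ b := by omega
  have hws := conjTranspose_mul_eq_zero_of_complement hw hs hs'
  have hsw : sᴴ * w = 0 := by
    simpa using congrArg Matrix.conjTranspose hws
  have hqu : qᴴ * u = 0 := by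
    simpa using congrArg Matrix.conjTranspose
      (conjTranspose_mul_eq_zero_of_complement hu hq hq')
  -- The complement of the range of `u` has dimension `a ≤ b`, so a coordinate inclusion `t` carries
  -- it into the complement of the range of `w`.
  let t : Matrix (Fin b) (Fin a) ℂ := (1 : Matrix (Fin b) (Fin b) ℂ).submatrix id (Fin.castLE hab)
  have ht : tᴴ * t = 1 := by
    rw [Matrix.conjTranspose_submatrix, ← Matrix.submatrix_mul _ _ _ id _ Function.bijective_id,
      Matrix.conjTranspose_one, Matrix.mul_one,
      Matrix.submatrix_one _ (Fin.castLE_injective hab)]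
  refine ⟨w * uᴴ + s * t * qᴴ, ?_, ?_⟩
  · rw [← hq']
    simp only [Matrix.conjTranspose_add, Matrix.conjTranspose_mul,
      Matrix.conjTranspose_conjTranspose, Matrix.mul_add, Matrix.add_mul]
    have e1 : u * wᴴ * (w * uᴴ) = u * uᴴ := by
      rw [Matrix.mul_assoc, ← Matrix.mul_assoc wᴴ, hw, Matrix.one_mul]
    have e2 : u * wᴴ * (s * t * qᴴ) = 0 := by
      rw [Matrix.mul_assoc, Matrix.mul_assoc s, ← Matrix.mul_assoc wᴴ, hws]; simp
    have e3 : q * (tᴴ * sᴴ) * (w * uᴴ) = 0 := by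
      rw [Matrix.mul_assoc, Matrix.mul_assoc tᴴ, ← Matrix.mul_assoc sᴴ, hsw]; simp
    have e4 : q * (tᴴ * sᴴ) * (s * t * qᴴ) = q * qᴴ := by
      rw [Matrix.mul_assoc, Matrix.mul_assoc tᴴ, Matrix.mul_assoc s, ← Matrix.mul_assoc sᴴ, hs,
        Matrix.one_mul, ← Matrix.mul_assoc tᴴ, ht, Matrix.one_mul]
    rw [e1, e2, e3, e4, add_zero, zero_add]
  · rw [Matrix.add_mul, Matrix.mul_assoc, hu, Matrix.mul_one, Matrix.mul_assoc, hqu,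
      Matrix.mul_zero, add_zero]

end Isometries

/-! ### Orthogonal decomposition into irreducible representations. -/

section Decomposition

variable {F : Type*} [Group F] {d : ℕ}

/-- The condition `0 < d` accounts for the nontriviality of the lattice of subrepresentations. -/
theorem isIrreducible_matRep_iff {R : F →* Matrix.unitaryGroup (Fin d) ℂ} :
    (matRep R).IsIrreducible ↔ 0 < d ∧ ∀ W : Submodule ℂ (Fin d → ℂ),
      (∀ g, ∀ v ∈ W, (R g : Matrix (Fin d) (Fin d) ℂ) *ᵥ v ∈ W) → W = ⊥ ∨ W = ⊤ := by
  constructor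
  · intro h
    refine ⟨dim_pos_of_isIrreducible h, fun W hW => ?_⟩
    rcases h.eq_bot_or_eq_top ⟨W, fun g v hv => hW g v hv⟩ with h1 | h1
    · exact Or.inl (congrArg Subrepresentation.toSubmodule h1)
    · exact Or.inr (congrArg Subrepresentation.toSubmodule h1)
  · rintro ⟨hd, h⟩
    have : Nontrivial (Subrepresentation (matRep R)) := by
      refine ⟨⊥, ⊤, fun h1 => ?_⟩
      have h2 : (⊥ : Submodule ℂ (Fin d → ℂ)) = ⊤ := congrArg Subrepresentation.toSubmodule h1
      have : Nonempty (Fin d) := ⟨⟨0, hd⟩⟩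
      exact bot_ne_top h2
    refine ⟨fun W => ?_⟩
    rcases h W.toSubmodule fun g v hv => W.apply_mem_toSubmodule g hv with h1 | h1
    · exact Or.inl (Subrepresentation.toSubmodule_injective h1)
    · exact Or.inr (Subrepresentation.toSubmodule_injective h1)

/-- The compression of a unitary representation to an invariant subspace. -/
def compress (R : F →* Matrix.unitaryGroup (Fin d) ℂ) {a : ℕ} (p : Matrix (Fin d) (Fin a) ℂ)
    (hp : pᴴ * p = 1)
    (hR : ∀ g, (R g : Matrix (Fin d) (Fin d) ℂ) * p =
      p * (pᴴ * (R g : Matrix (Fin d) (Fin d) ℂ) * p)) :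
    F →* Matrix.unitaryGroup (Fin a) ℂ where
  toFun g := ⟨pᴴ * (R g : Matrix (Fin d) (Fin d) ℂ) * p, by
    rw [Matrix.mem_unitaryGroup_iff', Matrix.star_eq_conjTranspose]
    rw [Matrix.conjTranspose_mul, Matrix.conjTranspose_mul, Matrix.conjTranspose_conjTranspose,
      Matrix.mul_assoc, Matrix.mul_assoc, ← hR,
      ← Matrix.mul_assoc _ _ p, unitary_conjTranspose_mul_self, Matrix.one_mul, hp]⟩
  map_one' := Subtype.ext (by simp [hp])
  map_mul' g h := Subtype.ext (by
    simp only [map_mul, Submonoid.coe_mul]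
    rw [Matrix.mul_assoc, Matrix.mul_assoc (R g : Matrix (Fin d) (Fin d) ℂ), hR h]
    simp only [Matrix.mul_assoc])

/-- A decomposition of a unitary representation as an orthogonal sum of irreducible ones. -/
structure IrreducibleDecomposition (R : F →* Matrix.unitaryGroup (Fin d) ℂ) where
  ι : Type
  fintype : Fintype ι
  n : ι → ℕ
  w : ∀ k, Matrix (Fin d) (Fin (n k)) ℂ
  S : ∀ k, F →* Matrix.unitaryGroup (Fin (n k)) ℂ
  irreducible : ∀ k, (matRep (S k)).IsIrreducible
  isometry : ∀ k, (w k)ᴴ * w k = 1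
  orthogonal : ∀ k l, k ≠ l → (w k)ᴴ * w l = 0
  sum_eq_one : ∑ k, w k * (w k)ᴴ = 1
  intertwines : ∀ k g, (R g : Matrix (Fin d) (Fin d) ℂ) * w k =
    w k * (S k g : Matrix (Fin (n k)) (Fin (n k)) ℂ)

attribute [instance] IrreducibleDecomposition.fintype

/-- Decompositions of two complementary subrepresentations combine. -/
def IrreducibleDecomposition.sum {R : F →* Matrix.unitaryGroup (Fin d) ℂ} {a b : ℕ}
    {p : Matrix (Fin d) (Fin a) ℂ} {q : Matrix (Fin d) (Fin b) ℂ}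
    (hp : pᴴ * p = 1) (hq : qᴴ * q = 1) (hpq : p * pᴴ + q * qᴴ = 1)
    {R₁ : F →* Matrix.unitaryGroup (Fin a) ℂ} {R₂ : F →* Matrix.unitaryGroup (Fin b) ℂ}
    (h₁ : ∀ g, (R g : Matrix (Fin d) (Fin d) ℂ) * p = p * (R₁ g : Matrix (Fin a) (Fin a) ℂ))
    (h₂ : ∀ g, (R g : Matrix (Fin d) (Fin d) ℂ) * q = q * (R₂ g : Matrix (Fin b) (Fin b) ℂ))
    (D₁ : IrreducibleDecomposition R₁) (D₂ : IrreducibleDecomposition R₂) :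
    IrreducibleDecomposition R where
  ι := D₁.ι ⊕ D₂.ι
  fintype := inferInstance
  n := Sum.elim D₁.n D₂.n
  w := Sum.rec (fun k => p * D₁.w k) (fun k => q * D₂.w k)
  S := Sum.rec D₁.S D₂.S
  irreducible := by
    rintro (k | k)
    · exact D₁.irreducible k
    · exact D₂.irreducible k
  isometry := by
    rintro (k | k)
    · change (p * D₁.w k)ᴴ * (p * D₁.w k) = 1
      rw [Matrix.conjTranspose_mul, Matrix.mul_assoc, ← Matrix.mul_assoc pᴴ, hp, Matrix.one_mul,
        D₁.isometry]
    · change (q * D₂.w k)ᴴ * (q * D₂.w k) = 1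
      rw [Matrix.conjTranspose_mul, Matrix.mul_assoc, ← Matrix.mul_assoc qᴴ, hq, Matrix.one_mul,
        D₂.isometry]
  orthogonal := by
    have h := conjTranspose_mul_eq_zero_of_complement hp hq hpq
    have h' := conjTranspose_mul_eq_zero_of_complement hq hp (by rw [add_comm, hpq])
    rintro (k | k) (l | l) hkl
    · change (p * D₁.w k)ᴴ * (p * D₁.w l) = 0
      rw [Matrix.conjTranspose_mul, Matrix.mul_assoc, ← Matrix.mul_assoc pᴴ, hp, Matrix.one_mul,
        D₁.orthogonal k l fun e => hkl (e ▸ rfl)]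
    · change (p * D₁.w k)ᴴ * (q * D₂.w l) = 0
      rw [Matrix.conjTranspose_mul, Matrix.mul_assoc, ← Matrix.mul_assoc pᴴ, h, Matrix.zero_mul,
        Matrix.mul_zero]
    · change (q * D₂.w k)ᴴ * (p * D₁.w l) = 0
      rw [Matrix.conjTranspose_mul, Matrix.mul_assoc, ← Matrix.mul_assoc qᴴ, h', Matrix.zero_mul,
        Matrix.mul_zero]
    · change (q * D₂.w k)ᴴ * (q * D₂.w l) = 0
      rw [Matrix.conjTranspose_mul, Matrix.mul_assoc, ← Matrix.mul_assoc qᴴ, hq, Matrix.one_mul,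
        D₂.orthogonal k l fun e => hkl (e ▸ rfl)]
  sum_eq_one := by
    rw [Fintype.sum_sum_type, ← hpq]
    congr 1
    · calc ∑ k, p * D₁.w k * (p * D₁.w k)ᴴ = p * (∑ k, D₁.w k * (D₁.w k)ᴴ) * pᴴ := by
            simp only [Matrix.conjTranspose_mul, Matrix.mul_sum, Matrix.sum_mul, Matrix.mul_assoc]
        _ = p * pᴴ := by rw [D₁.sum_eq_one, Matrix.mul_one]
    · calc ∑ k, q * D₂.w k * (q * D₂.w k)ᴴ = q * (∑ k, D₂.w k * (D₂.w k)ᴴ) * qᴴ := by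
            simp only [Matrix.conjTranspose_mul, Matrix.mul_sum, Matrix.sum_mul, Matrix.mul_assoc]
        _ = q * qᴴ := by rw [D₂.sum_eq_one, Matrix.mul_one]
  intertwines := by
    rintro (k | k) g
    · change (R g : Matrix (Fin d) (Fin d) ℂ) * (p * D₁.w k) =
        p * D₁.w k * (D₁.S k g : Matrix (Fin (D₁.n k)) (Fin (D₁.n k)) ℂ)
      rw [← Matrix.mul_assoc, h₁, Matrix.mul_assoc, D₁.intertwines, Matrix.mul_assoc]
    · change (R g : Matrix (Fin d) (Fin d) ℂ) * (q * D₂.w k) =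
        q * D₂.w k * (D₂.S k g : Matrix (Fin (D₂.n k)) (Fin (D₂.n k)) ℂ)
      rw [← Matrix.mul_assoc, h₂, Matrix.mul_assoc, D₂.intertwines, Matrix.mul_assoc]

/-- Invariance is stated through a projection that commutes with `R`, because the complementary
projection then commutes as well. -/
theorem exists_invariant_isometry {R : F →* Matrix.unitaryGroup (Fin d) ℂ} (hd : 0 < d)
    (h : ¬ (matRep R).IsIrreducible) :
    ∃ (a : ℕ) (p : Matrix (Fin d) (Fin a) ℂ), 0 < a ∧ a < d ∧ pᴴ * p = 1 ∧
      ∀ g, (R g : Matrix (Fin d) (Fin d) ℂ) * (p * pᴴ) =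
        (p * pᴴ) * (R g : Matrix (Fin d) (Fin d) ℂ) := by
  rw [isIrreducible_matRep_iff] at h
  push Not at h
  obtain ⟨W, hW, hbot, htop⟩ := h hd
  let W' : Submodule ℂ (EuclideanSpace ℂ (Fin d)) :=
    W.comap (WithLp.linearEquiv 2 ℂ (Fin d → ℂ)).toLinearMap
  have hmem : ∀ v : EuclideanSpace ℂ (Fin d), v ∈ W' ↔ WithLp.ofLp v ∈ W := fun v => Iff.rfl
  obtain ⟨a, p, hp, hp1, hp2, -⟩ := exists_isometry_onto_submodule W'
  have hp1' : ∀ x, p *ᵥ x ∈ W := hp1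
  have hp2' : ∀ v ∈ W, (p * pᴴ) *ᵥ v = v := fun v hv => hp2 (WithLp.toLp 2 v) hv
  have hinv : ∀ g, (p * pᴴ) * (R g : Matrix (Fin d) (Fin d) ℂ) * (p * pᴴ) =
      (R g : Matrix (Fin d) (Fin d) ℂ) * (p * pᴴ) := by
    intro g
    apply Matrix.toLin'.injective
    refine LinearMap.ext fun v => ?_
    simp only [Matrix.toLin'_apply, ← Matrix.mulVec_mulVec]
    have := hp2' _ (hW g _ (hp1' (pᴴ *ᵥ v)))
    rwa [← Matrix.mulVec_mulVec] at this
  -- The adjoint of `hinv` at `g⁻¹`; together the two show that the projection commutes with `R g`.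
  have hinv' : ∀ g, (p * pᴴ) * (R g : Matrix (Fin d) (Fin d) ℂ) * (p * pᴴ) =
      (p * pᴴ) * (R g : Matrix (Fin d) (Fin d) ℂ) := by
    intro g
    have := congrArg Matrix.conjTranspose (hinv g⁻¹)
    simpa only [Matrix.conjTranspose_mul, Matrix.conjTranspose_conjTranspose,
      conjTranspose_coe_map, inv_inv, Matrix.mul_assoc] using this
  obtain ⟨b, q, hq, hq'⟩ := exists_complement_isometry p hp
  have hab := trace_complement_isometry hp hq hq'
  simp only [Fintype.card_fin] at hab
  refine ⟨a, p, ?_, ?_, hp, fun g => ?_⟩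
  · rcases Nat.eq_zero_or_pos a with rfl | ha
    · refine absurd ((Submodule.eq_bot_iff _).2 fun v hv => ?_) hbot
      rw [← hp2' v hv, ← Matrix.mulVec_mulVec, Subsingleton.elim (pᴴ *ᵥ v) 0, Matrix.mulVec_zero]
    · exact ha
  · rcases Nat.eq_zero_or_pos b with rfl | hb
    · refine absurd ((Submodule.eq_top_iff').2 fun v => ?_) htop
      have : q * qᴴ = 0 := by ext; simp [Matrix.mul_apply]
      rw [this, add_zero] at hq'
      rw [← Matrix.one_mulVec v, ← hq', ← Matrix.mulVec_mulVec]
      exact hp1' _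
    · omega
  · rw [← hinv, hinv']

/-- Induction on the dimension: a reducible representation splits along an invariant subspace and
its orthogonal complement. Unitarity replaces averaging, so `F` may be infinite, as it must be for
free groups. Dimension zero has the empty decomposition. -/
theorem nonempty_irreducibleDecomposition (R : F →* Matrix.unitaryGroup (Fin d) ℂ) :
    Nonempty (IrreducibleDecomposition R) := by
  induction d using Nat.strong_induction_on with
  | _ d ih =>
  rcases Nat.eq_zero_or_pos d with rfl | hd
  · exact ⟨{ ι := Empty, fintype := inferInstance, n := Empty.elim, w := fun k => k.elim,
             S := fun k => k.elim, irreducible := fun k => k.elim, isometry := fun k => k.elim,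
             orthogonal := fun k => k.elim, sum_eq_one := Subsingleton.elim _ _,
             intertwines := fun k => k.elim }⟩
  by_cases h : (matRep R).IsIrreducible
  · exact ⟨{ ι := Unit, fintype := inferInstance, n := fun _ => d, w := fun _ => 1,
             S := fun _ => R, irreducible := fun _ => h, isometry := fun _ => by simp,
             orthogonal := fun k l hkl => absurd (Subsingleton.elim k l) hkl,
             sum_eq_one := by simp,
             intertwines := fun _ g => by simp }⟩
  obtain ⟨a, p, ha, had, hp, hcomm⟩ := exists_invariant_isometry hd h
  obtain ⟨b, q, hq, hq'⟩ := exists_complement_isometry p hp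
  have hab := trace_complement_isometry hp hq hq'
  simp only [Fintype.card_fin] at hab
  have hRp : ∀ g, (R g : Matrix (Fin d) (Fin d) ℂ) * p =
      p * (pᴴ * (R g : Matrix (Fin d) (Fin d) ℂ) * p) := by
    intro g
    rw [← Matrix.mul_assoc, ← Matrix.mul_assoc, ← hcomm, Matrix.mul_assoc, Matrix.mul_assoc p, hp,
      Matrix.mul_one]
  have hcomm' : ∀ g, (R g : Matrix (Fin d) (Fin d) ℂ) * (q * qᴴ) =
      (q * qᴴ) * (R g : Matrix (Fin d) (Fin d) ℂ) := by
    intro g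
    rw [eq_sub_of_add_eq' hq', Matrix.mul_sub, Matrix.sub_mul, hcomm, Matrix.mul_one,
      Matrix.one_mul]
  have hRq : ∀ g, (R g : Matrix (Fin d) (Fin d) ℂ) * q =
      q * (qᴴ * (R g : Matrix (Fin d) (Fin d) ℂ) * q) := by
    intro g
    rw [← Matrix.mul_assoc, ← Matrix.mul_assoc, ← hcomm', Matrix.mul_assoc, Matrix.mul_assoc q, hq,
      Matrix.mul_one]
  obtain ⟨D₁⟩ := ih a had (compress R p hp hRp)
  obtain ⟨D₂⟩ := ih b (by omega) (compress R q hq hRq)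
  exact ⟨D₁.sum hp hq hq' hRp hRq D₂⟩

end Decomposition

/-! ### Matrices acting on Euclidean spaces. -/

section EuclideanLin

variable {X Y Z : Type*} [Fintype X] [DecidableEq X] [Fintype Y] [DecidableEq Y]

theorem toEuclideanLin_mul_apply (M : Matrix Z Y ℂ) (N : Matrix Y X ℂ) (v : EuclideanSpace ℂ X) :
    Matrix.toEuclideanLin (M * N) v = Matrix.toEuclideanLin M (Matrix.toEuclideanLin N v) := by
  apply WithLp.ofLp_injective
  exact (Matrix.mulVec_mulVec _ _ _).symm

theorem toEuclideanLin_one_apply (v : EuclideanSpace ℂ X) :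
    Matrix.toEuclideanLin (1 : Matrix X X ℂ) v = v := by
  apply WithLp.ofLp_injective
  exact Matrix.one_mulVec _

theorem inner_toEuclideanLin_left (M : Matrix Y X ℂ) (x : EuclideanSpace ℂ X)
    (y : EuclideanSpace ℂ Y) :
    inner ℂ (Matrix.toEuclideanLin M x) y = inner ℂ x (Matrix.toEuclideanLin Mᴴ y) := by
  rw [Matrix.toEuclideanLin_conjTranspose_eq_adjoint, LinearMap.adjoint_inner_right]

theorem norm_toEuclideanLin_of_isometry {M : Matrix Y X ℂ} (hM : Mᴴ * M = 1)
    (x : EuclideanSpace ℂ X) : ‖Matrix.toEuclideanLin M x‖ = ‖x‖ := by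
  rw [@norm_eq_sqrt_re_inner ℂ, @norm_eq_sqrt_re_inner ℂ _ _ _ _ x, inner_toEuclideanLin_left,
    ← toEuclideanLin_mul_apply, hM, toEuclideanLin_one_apply]

end EuclideanLin

theorem kronecker_isometry {X Y X' Y' : Type*} [Fintype X] [DecidableEq X] [Fintype Y]
    [Fintype X'] [DecidableEq X'] [Fintype Y'] {M : Matrix Y X ℂ} {N : Matrix Y' X' ℂ}
    (hM : Mᴴ * M = 1) (hN : Nᴴ * N = 1) : (M ⊗ₖ N)ᴴ * (M ⊗ₖ N) = 1 := by
  rw [Matrix.conjTranspose_kronecker, ← Matrix.mul_kronecker_mul, hM, hN, Matrix.one_kronecker_one]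

/-! ### The winning form and its behaviour under intertwiners. -/

section GameForm

/-- The outcome projections are polynomials in the observable. -/
theorem mul_observableProj {d e n : ℕ} {M : Matrix (Fin e) (Fin d) ℂ} {X : Matrix (Fin d) (Fin d) ℂ}
    {R : Matrix (Fin e) (Fin e) ℂ} (h : M * X = R * M) (a : Fin n) :
    M * observableProj n X a = observableProj n R a * M := by
  unfold observableProj
  have hpow : ∀ (c : ℂ) (k : ℕ), M * (c • X) ^ k = (c • R) ^ k * M := by
    intro c k
    induction k with
    | zero => simp
    | succ k ih =>
      rw [pow_succ, pow_succ, ← Matrix.mul_assoc, ih, Matrix.mul_assoc, Matrix.mul_assoc,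
        Matrix.mul_smul, Matrix.smul_mul, h]
  simp only [Matrix.mul_smul, Matrix.smul_mul, Matrix.mul_sum, Matrix.sum_mul, hpow]

theorem isometry_pow {d : ℕ} {U : Matrix (Fin d) (Fin d) ℂ} (hU : Uᴴ * U = 1) (k : ℕ) :
    (U ^ k)ᴴ * U ^ k = 1 := by
  have : U ∈ Matrix.unitaryGroup (Fin d) ℂ := Matrix.mem_unitaryGroup_iff'.2 hU
  exact Matrix.mem_unitaryGroup_iff'.1 (pow_mem this k)

theorem isometry_smul_inv_exp {d : ℕ} {U : Matrix (Fin d) (Fin d) ℂ} (hU : Uᴴ * U = 1) (n a : ℕ) :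
    (((Complex.exp (2 * Real.pi * Complex.I / n))⁻¹ ^ a) • U)ᴴ *
      (((Complex.exp (2 * Real.pi * Complex.I / n))⁻¹ ^ a) • U) = 1 := by
  have h1 : ‖(Complex.exp (2 * Real.pi * Complex.I / n))⁻¹ ^ a‖ = 1 := by
    have : 2 * Real.pi * Complex.I / n = ((2 * Real.pi / n : ℝ) : ℂ) * Complex.I := by
      push_cast; ring
    rw [norm_pow, norm_inv, this, Complex.norm_exp_ofReal_mul_I, inv_one, one_pow]
  rw [Matrix.conjTranspose_smul, Matrix.smul_mul, Matrix.mul_smul, hU, smul_smul,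
    Complex.star_def, Complex.conj_mul', h1]
  simp

/-- Each factor is an average of unitary matrices, so the triangle inequality suffices; that the
factors are projections plays no role. -/
theorem norm_observableProj_kronecker_le {d e nA nB : ℕ} [NeZero nA] [NeZero nB]
    {U : Matrix (Fin d) (Fin d) ℂ}
    {V : Matrix (Fin e) (Fin e) ℂ} (hU : Uᴴ * U = 1) (hV : Vᴴ * V = 1) (a : Fin nA) (b : Fin nB)
    (ψ : EuclideanSpace ℂ (Fin d × Fin e)) :
    ‖Matrix.toEuclideanLin (observableProj nA U a ⊗ₖ observableProj nB V b) ψ‖ ≤ ‖ψ‖ := by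
  have hsum : ∀ (s t : Finset ℕ) (f : ℕ → Matrix (Fin d) (Fin d) ℂ)
      (g : ℕ → Matrix (Fin e) (Fin e) ℂ),
      (∑ k ∈ s, f k) ⊗ₖ (∑ l ∈ t, g l) = ∑ k ∈ s, ∑ l ∈ t, f k ⊗ₖ g l := by
    intro s t f g
    ext i j
    simp only [Matrix.kroneckerMap_apply, Matrix.sum_apply, Finset.sum_mul_sum]
  unfold observableProj
  rw [Matrix.smul_kronecker, Matrix.kronecker_smul, hsum, map_smul, map_smul, LinearMap.smul_apply,
    LinearMap.smul_apply, norm_smul, norm_smul]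
  have hle : ‖Matrix.toEuclideanLin (∑ k ∈ Finset.range nA, ∑ l ∈ Finset.range nB,
      ((((Complex.exp (2 * Real.pi * Complex.I / nA))⁻¹ ^ (a : ℕ) • U) ^ k) ⊗ₖ
      (((Complex.exp (2 * Real.pi * Complex.I / nB))⁻¹ ^ (b : ℕ) • V) ^ l))) ψ‖ ≤
      nA * (nB * ‖ψ‖) := by
    rw [map_sum, LinearMap.sum_apply]
    calc _ ≤ ∑ k ∈ Finset.range nA, (nB * ‖ψ‖) := by
          refine norm_sum_le_of_le _ fun k _ => ?_
          rw [map_sum, LinearMap.sum_apply]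
          calc _ ≤ ∑ l ∈ Finset.range nB, ‖ψ‖ := by
                refine norm_sum_le_of_le _ fun l _ => le_of_eq ?_
                exact norm_toEuclideanLin_of_isometry (kronecker_isometry
                  (isometry_pow (isometry_smul_inv_exp hU _ _) _)
                  (isometry_pow (isometry_smul_inv_exp hV _ _) _)) _
            _ = nB * ‖ψ‖ := by simp
      _ = nA * (nB * ‖ψ‖) := by simp
  have hA : (nA : ℝ) ≠ 0 := by exact_mod_cast NeZero.ne nA
  have hB : (nB : ℝ) ≠ 0 := by exact_mod_cast NeZero.ne nB
  calc _ ≤ ‖(1 / (nA : ℂ))‖ * (‖(1 / (nB : ℂ))‖ * (nA * (nB * ‖ψ‖))) := by gcongr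
    _ = ‖ψ‖ := by
      simp only [norm_div, norm_one, Complex.norm_natCast]
      field_simp

variable {IA IB : Type*} [Fintype IA] [Fintype IB] {nA nB : ℕ} (𝒢 : NonlocalGame IA IB nA nB)

/-- The game operator `∑ π(i,j) V(i,j,a,b) E_{i,a} ⊗ F_{j,b}`. -/
noncomputable def NonlocalGame.gameOp {dA dB : ℕ} (X : IA → Matrix (Fin dA) (Fin dA) ℂ)
    (Y : IB → Matrix (Fin dB) (Fin dB) ℂ) : Matrix (Fin dA × Fin dB) (Fin dA × Fin dB) ℂ :=
  ∑ i, ∑ j, ∑ a, ∑ b, ((𝒢.prob i j * (if 𝒢.wins i j a b then 1 else 0) : ℝ) : ℂ) •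
    (observableProj nA (X i) a ⊗ₖ observableProj nB (Y j) b)

/-- The quadratic form of the game operator. -/
noncomputable def NonlocalGame.winForm {dA dB : ℕ} (X : IA → Matrix (Fin dA) (Fin dA) ℂ)
    (Y : IB → Matrix (Fin dB) (Fin dB) ℂ) (φ : EuclideanSpace ℂ (Fin dA × Fin dB)) : ℝ :=
  (inner ℂ φ (Matrix.toEuclideanLin (𝒢.gameOp X Y) φ)).re

variable {𝒢}

theorem NonlocalGame.value_eq_winForm {dA dB : ℕ} (S : QStrategy IA IB nA nB dA dB) :
    𝒢.value S = 𝒢.winForm (fun i => (S.A i : Matrix (Fin dA) (Fin dA) ℂ))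
      (fun j => (S.B j : Matrix (Fin dB) (Fin dB) ℂ)) S.ψ := by
  unfold NonlocalGame.value NonlocalGame.winForm NonlocalGame.gameOp
  simp only [map_sum, LinearMap.sum_apply, inner_sum, Complex.re_sum, map_smul,
    LinearMap.smul_apply, inner_smul_right, Complex.re_ofReal_mul]
  refine Finset.sum_congr rfl fun i _ => Finset.sum_congr rfl fun j _ =>
    Finset.sum_congr rfl fun a _ => Finset.sum_congr rfl fun b _ => ?_
  ring

theorem NonlocalGame.winForm_smul {dA dB : ℕ} (X : IA → Matrix (Fin dA) (Fin dA) ℂ)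
    (Y : IB → Matrix (Fin dB) (Fin dB) ℂ) (c : ℂ) (φ : EuclideanSpace ℂ (Fin dA × Fin dB)) :
    𝒢.winForm X Y (c • φ) = ‖c‖ ^ 2 * 𝒢.winForm X Y φ := by
  unfold NonlocalGame.winForm
  rw [map_smul, inner_smul_left, inner_smul_right, ← mul_assoc, Complex.conj_mul',
    ← Complex.ofReal_pow, Complex.re_ofReal_mul]

theorem NonlocalGame.kronecker_mul_gameOp {dA dB eA eB : ℕ} {X : IA → Matrix (Fin dA) (Fin dA) ℂ}
    {Y : IB → Matrix (Fin dB) (Fin dB) ℂ} {R : IA → Matrix (Fin eA) (Fin eA) ℂ}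
    {S : IB → Matrix (Fin eB) (Fin eB) ℂ} {M : Matrix (Fin eA) (Fin dA) ℂ}
    {N : Matrix (Fin eB) (Fin dB) ℂ} (hM : ∀ i, M * X i = R i * M) (hN : ∀ j, N * Y j = S j * N) :
    (M ⊗ₖ N) * 𝒢.gameOp X Y = 𝒢.gameOp R S * (M ⊗ₖ N) := by
  unfold NonlocalGame.gameOp
  simp only [Matrix.mul_sum, Matrix.sum_mul, Matrix.mul_smul, Matrix.smul_mul,
    ← Matrix.mul_kronecker_mul, mul_observableProj (hM _), mul_observableProj (hN _)]

/-- Serves two purposes: for `M`, `N` adjoint to block embeddings, the weights `Mᴴ * M ⊗ Nᴴ * N` sum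
to 1 over all pairs of blocks; for `M`, `N` unitary, the weight is 1 and the form is preserved. -/
theorem NonlocalGame.winForm_toEuclideanLin {dA dB eA eB : ℕ}
    {X : IA → Matrix (Fin dA) (Fin dA) ℂ}
    {Y : IB → Matrix (Fin dB) (Fin dB) ℂ} {R : IA → Matrix (Fin eA) (Fin eA) ℂ}
    {S : IB → Matrix (Fin eB) (Fin eB) ℂ} {M : Matrix (Fin eA) (Fin dA) ℂ}
    {N : Matrix (Fin eB) (Fin dB) ℂ} (hM : ∀ i, M * X i = R i * M) (hN : ∀ j, N * Y j = S j * N)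
    (φ : EuclideanSpace ℂ (Fin dA × Fin dB)) :
    𝒢.winForm R S (Matrix.toEuclideanLin (M ⊗ₖ N) φ) =
      (inner ℂ φ (Matrix.toEuclideanLin ((Mᴴ * M) ⊗ₖ (Nᴴ * N))
        (Matrix.toEuclideanLin (𝒢.gameOp X Y) φ))).re := by
  unfold NonlocalGame.winForm
  rw [inner_toEuclideanLin_left, ← toEuclideanLin_mul_apply, ← toEuclideanLin_mul_apply,
    ← toEuclideanLin_mul_apply, Matrix.mul_assoc, ← kronecker_mul_gameOp hM hN,
    Matrix.conjTranspose_kronecker,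
    ← Matrix.mul_assoc, ← Matrix.mul_kronecker_mul]

theorem sum_kronecker_sum {κ κ' X Y X' Y' : Type*} [Fintype κ] [Fintype κ']
    (f : κ → Matrix X Y ℂ) (g : κ' → Matrix X' Y' ℂ) :
    ∑ k, ∑ l, f k ⊗ₖ g l = (∑ k, f k) ⊗ₖ (∑ l, g l) := by
  ext i j
  simp only [Matrix.kroneckerMap_apply, Matrix.sum_apply, Finset.sum_mul_sum]

/-- The quadratic form decomposes along invariant decompositions of both factors. -/
theorem NonlocalGame.winForm_eq_sum {dA dB : ℕ} {κ κ' : Type*} [Fintype κ] [Fintype κ']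
    {n : κ → ℕ} {m : κ' → ℕ}
    {X : IA → Matrix (Fin dA) (Fin dA) ℂ} {Y : IB → Matrix (Fin dB) (Fin dB) ℂ}
    {R : ∀ k, IA → Matrix (Fin (n k)) (Fin (n k)) ℂ}
    {S : ∀ l, IB → Matrix (Fin (m l)) (Fin (m l)) ℂ}
    {w : ∀ k, Matrix (Fin dA) (Fin (n k)) ℂ} {v : ∀ l, Matrix (Fin dB) (Fin (m l)) ℂ}
    (hw : ∀ k i, (w k)ᴴ * X i = R k i * (w k)ᴴ) (hv : ∀ l j, (v l)ᴴ * Y j = S l j * (v l)ᴴ)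
    (hw1 : ∑ k, w k * (w k)ᴴ = 1) (hv1 : ∑ l, v l * (v l)ᴴ = 1)
    (φ : EuclideanSpace ℂ (Fin dA × Fin dB)) :
    𝒢.winForm X Y φ =
      ∑ k, ∑ l, 𝒢.winForm (R k) (S l) (Matrix.toEuclideanLin ((w k)ᴴ ⊗ₖ (v l)ᴴ) φ) := by
  simp only [winForm_toEuclideanLin (hw _) (hv _), Matrix.conjTranspose_conjTranspose]
  simp only [← Complex.re_sum, ← inner_sum, ← LinearMap.sum_apply, ← map_sum, sum_kronecker_sum,
    hw1, hv1, Matrix.one_kronecker_one, toEuclideanLin_one_apply]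
  rfl

theorem sum_toEuclideanLin_components {dA dB : ℕ} {κ κ' : Type*} [Fintype κ] [Fintype κ']
    {n : κ → ℕ} {m : κ' → ℕ}
    {w : ∀ k, Matrix (Fin dA) (Fin (n k)) ℂ} {v : ∀ l, Matrix (Fin dB) (Fin (m l)) ℂ}
    (hw1 : ∑ k, w k * (w k)ᴴ = 1) (hv1 : ∑ l, v l * (v l)ᴴ = 1)
    (φ : EuclideanSpace ℂ (Fin dA × Fin dB)) :
    ∑ k, ∑ l, Matrix.toEuclideanLin (w k ⊗ₖ v l)
      (Matrix.toEuclideanLin ((w k)ᴴ ⊗ₖ (v l)ᴴ) φ) = φ := by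
  simp only [← toEuclideanLin_mul_apply, ← Matrix.mul_kronecker_mul]
  simp only [← LinearMap.sum_apply, ← map_sum, sum_kronecker_sum,
    hw1, hv1, Matrix.one_kronecker_one, toEuclideanLin_one_apply]

theorem sum_norm_sq_components {dA dB : ℕ} {κ κ' : Type*} [Fintype κ] [Fintype κ']
    {n : κ → ℕ} {m : κ' → ℕ}
    {w : ∀ k, Matrix (Fin dA) (Fin (n k)) ℂ} {v : ∀ l, Matrix (Fin dB) (Fin (m l)) ℂ}
    (hw1 : ∑ k, w k * (w k)ᴴ = 1) (hv1 : ∑ l, v l * (v l)ᴴ = 1)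
    (φ : EuclideanSpace ℂ (Fin dA × Fin dB)) :
    ∑ k, ∑ l, ‖Matrix.toEuclideanLin ((w k)ᴴ ⊗ₖ (v l)ᴴ) φ‖ ^ 2 = ‖φ‖ ^ 2 := by
  have h : ∀ k l, ‖Matrix.toEuclideanLin ((w k)ᴴ ⊗ₖ (v l)ᴴ) φ‖ ^ 2 =
      (inner ℂ φ (Matrix.toEuclideanLin (w k ⊗ₖ v l)
        (Matrix.toEuclideanLin ((w k)ᴴ ⊗ₖ (v l)ᴴ) φ))).re := by
    intro k l
    rw [@norm_sq_eq_re_inner ℂ, inner_toEuclideanLin_left, Matrix.conjTranspose_kronecker,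
      Matrix.conjTranspose_conjTranspose, Matrix.conjTranspose_conjTranspose]
    rfl
  simp only [h, ← Complex.re_sum, ← inner_sum, sum_toEuclideanLin_components hw1 hv1]
  rw [@norm_sq_eq_re_inner ℂ]
  rfl

theorem norm_inv_norm_smul {E : Type*} [NormedAddCommGroup E] [NormedSpace ℂ E] {φ : E}
    (hφ : φ ≠ 0) : ‖((‖φ‖⁻¹ : ℝ) : ℂ) • φ‖ = 1 := by
  rw [norm_smul, Complex.norm_real, norm_inv, norm_norm, inv_mul_cancel₀ (norm_ne_zero_iff.2 hφ)]

theorem NonlocalGame.isOptimal_normalize {dA dB : ℕ} {A : IA → Matrix.unitaryGroup (Fin dA) ℂ}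
    {B : IB → Matrix.unitaryGroup (Fin dB) ℂ} (hA : ∀ i, A i ^ nA = 1) (hB : ∀ j, B j ^ nB = 1)
    {φ : EuclideanSpace ℂ (Fin dA × Fin dB)} (hφ : φ ≠ 0)
    (h : 𝒢.winForm (fun i => (A i : Matrix (Fin dA) (Fin dA) ℂ))
      (fun j => (B j : Matrix (Fin dB) (Fin dB) ℂ)) φ = 𝒢.quantumValue * ‖φ‖ ^ 2) :
    𝒢.IsOptimal (QStrategy.mk A B hA hB _ (norm_inv_norm_smul hφ)) := by
  have hpos : 0 < ‖φ‖ ^ 2 := by positivity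
  rw [NonlocalGame.IsOptimal, value_eq_winForm, winForm_smul, Complex.norm_real, norm_inv,
    norm_norm, inv_pow, inv_mul_eq_iff_eq_mul₀ hpos.ne', mul_comm]
  exact h

variable [NeZero nA] [NeZero nB]

/-- A crude bound, independent of the strategy and its dimensions. It is needed only so that the
supremum defining the quantum value is over a bounded set. -/
theorem NonlocalGame.value_le_sum {dA dB : ℕ} (S : QStrategy IA IB nA nB dA dB) :
    𝒢.value S ≤ ∑ i, ∑ j, ∑ _a : Fin nA, ∑ _b : Fin nB, 𝒢.prob i j := by
  unfold NonlocalGame.value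
  refine Finset.sum_le_sum fun i _ => Finset.sum_le_sum fun j _ =>
    Finset.sum_le_sum fun a _ => Finset.sum_le_sum fun b _ => ?_
  have h1 : (inner ℂ S.ψ (Matrix.toEuclideanLin
      (observableProj nA (S.A i : Matrix (Fin dA) (Fin dA) ℂ) a ⊗ₖ
        observableProj nB (S.B j : Matrix (Fin dB) (Fin dB) ℂ) b) S.ψ)).re ≤ 1 := by
    refine (Complex.re_le_norm _).trans ((norm_inner_le_norm _ _).trans ?_)
    rw [S.norm_ψ, one_mul]
    exact (norm_observableProj_kronecker_le (unitary_conjTranspose_mul_self _)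
      (unitary_conjTranspose_mul_self _) a b S.ψ).trans S.norm_ψ.le
  split_ifs
  · rw [mul_one]
    exact mul_le_of_le_one_right (𝒢.prob_nonneg i j) h1
  · rw [mul_zero]
    exact 𝒢.prob_nonneg i j

theorem NonlocalGame.value_le_quantumValue {dA dB : ℕ} (S : QStrategy IA IB nA nB dA dB) :
    𝒢.value S ≤ 𝒢.quantumValue := by
  refine le_csSup ⟨∑ i, ∑ j, ∑ _a : Fin nA, ∑ _b : Fin nB, 𝒢.prob i j, ?_⟩ ⟨dA, dB, S, rfl⟩
  rintro _ ⟨dA, dB, T, rfl⟩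
  exact value_le_sum T

/-- The homogeneous form of the bound applies to the components of a state, which are unnormalized
and may vanish. -/
theorem NonlocalGame.winForm_le {dA dB : ℕ} {A : IA → Matrix.unitaryGroup (Fin dA) ℂ}
    {B : IB → Matrix.unitaryGroup (Fin dB) ℂ} (hA : ∀ i, A i ^ nA = 1) (hB : ∀ j, B j ^ nB = 1)
    (φ : EuclideanSpace ℂ (Fin dA × Fin dB)) :
    𝒢.winForm (fun i => (A i : Matrix (Fin dA) (Fin dA) ℂ))
      (fun j => (B j : Matrix (Fin dB) (Fin dB) ℂ)) φ ≤ 𝒢.quantumValue * ‖φ‖ ^ 2 := by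
  by_cases hφ : φ = 0
  · simp [hφ, NonlocalGame.winForm]
  have h := value_le_quantumValue (𝒢 := 𝒢) (QStrategy.mk A B hA hB _ (norm_inv_norm_smul hφ))
  have hpos : 0 < ‖φ‖ ^ 2 := by positivity
  rw [value_eq_winForm, winForm_smul, Complex.norm_real, norm_inv, norm_norm, inv_pow,
    inv_mul_le_iff₀ hpos, mul_comm] at h
  exact h

/-- Every component of an optimal strategy is optimal. -/
theorem NonlocalGame.winForm_component_eq {dA dB : ℕ} {T : QStrategy IA IB nA nB dA dB}
    (hT : 𝒢.IsOptimal T) {κ κ' : Type*} [Fintype κ] [Fintype κ']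
    {n : κ → ℕ} {m : κ' → ℕ}
    {R : ∀ k, IA → Matrix.unitaryGroup (Fin (n k)) ℂ}
    {S : ∀ l, IB → Matrix.unitaryGroup (Fin (m l)) ℂ}
    (hR : ∀ k i, R k i ^ nA = 1) (hS : ∀ l j, S l j ^ nB = 1)
    {w : ∀ k, Matrix (Fin dA) (Fin (n k)) ℂ} {v : ∀ l, Matrix (Fin dB) (Fin (m l)) ℂ}
    (hw : ∀ k i, (w k)ᴴ * (T.A i : Matrix (Fin dA) (Fin dA) ℂ) =
      (R k i : Matrix (Fin (n k)) (Fin (n k)) ℂ) * (w k)ᴴ)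
    (hv : ∀ l j, (v l)ᴴ * (T.B j : Matrix (Fin dB) (Fin dB) ℂ) =
      (S l j : Matrix (Fin (m l)) (Fin (m l)) ℂ) * (v l)ᴴ)
    (hw1 : ∑ k, w k * (w k)ᴴ = 1) (hv1 : ∑ l, v l * (v l)ᴴ = 1) (k : κ) (l : κ') :
    𝒢.winForm (fun i => (R k i : Matrix (Fin (n k)) (Fin (n k)) ℂ))
      (fun j => (S l j : Matrix (Fin (m l)) (Fin (m l)) ℂ))
      (Matrix.toEuclideanLin ((w k)ᴴ ⊗ₖ (v l)ᴴ) T.ψ) =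
    𝒢.quantumValue * ‖Matrix.toEuclideanLin ((w k)ᴴ ⊗ₖ (v l)ᴴ) T.ψ‖ ^ 2 := by
  have hle := fun k l => winForm_le (𝒢 := 𝒢) (hR k) (hS l)
    (Matrix.toEuclideanLin ((w k)ᴴ ⊗ₖ (v l)ᴴ) T.ψ)
  have h1 := winForm_eq_sum (𝒢 := 𝒢) hw hv hw1 hv1 T.ψ
  rw [← value_eq_winForm, hT] at h1
  -- The squared norms of the components add up to 1, so the termwise upper bounds have the same sum
  -- as the terms themselves; each bound is therefore attained.
  have h2 : ∑ k, ∑ l, 𝒢.quantumValue * ‖Matrix.toEuclideanLin ((w k)ᴴ ⊗ₖ (v l)ᴴ) T.ψ‖ ^ 2 =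
      𝒢.quantumValue := by
    simp only [← Finset.mul_sum]
    rw [sum_norm_sq_components hw1 hv1, T.norm_ψ, one_pow, mul_one]
  have h3 := h1.symm.trans h2.symm
  have h4 := (Finset.sum_eq_sum_iff_of_le fun k _ => Finset.sum_le_sum fun l _ => hle k l).1 h3 k
    (Finset.mem_univ _)
  exact (Finset.sum_eq_sum_iff_of_le fun l _ => hle k l).1 h4 l (Finset.mem_univ _)

end GameForm

/-! ### Regrouping tensor products by party. -/

section TensorVec

variable {K K' S S' L L' T T' : Type*}

/-- The vector `|χ⟩|ψ⟩`, with the factors of the two parties grouped together. -/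
def tensorVec (χ : K × L → ℂ) (ψ : S × T → ℂ) : (K × S) × (L × T) → ℂ :=
  fun p => χ (p.1.1, p.2.1) * ψ (p.1.2, p.2.2)

/-- After the indices are regrouped from parties to junk and state, the sum factors. -/
theorem kronecker_mulVec_tensorVec [Fintype K] [Fintype S] [Fintype L] [Fintype T]
    (M : Matrix K' K ℂ) (M' : Matrix S' S ℂ) (N : Matrix L' L ℂ) (N' : Matrix T' T ℂ)
    (χ : K × L → ℂ) (ψ : S × T → ℂ) :
    ((M ⊗ₖ M') ⊗ₖ (N ⊗ₖ N')) *ᵥ tensorVec χ ψ =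
      tensorVec ((M ⊗ₖ N) *ᵥ χ) ((M' ⊗ₖ N') *ᵥ ψ) := by
  ext p
  simp only [Matrix.mulVec, dotProduct, tensorVec, Finset.sum_mul_sum]
  rw [← Fintype.sum_prod_type' (f := fun x y => _)]
  refine Fintype.sum_equiv (Equiv.prodProdProdComm K S L T) _ _ fun q => ?_
  simp only [Matrix.kroneckerMap_apply, Equiv.prodProdProdComm_apply]
  ring

theorem norm_bipartiteTensor {kA kB dA dB : ℕ} (χ : EuclideanSpace ℂ (Fin kA × Fin kB))
    (ψ : EuclideanSpace ℂ (Fin dA × Fin dB)) : ‖bipartiteTensor χ ψ‖ = ‖χ‖ * ‖ψ‖ := by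
  refine (sq_eq_sq₀ (norm_nonneg _) (by positivity)).1 ?_
  rw [mul_pow, EuclideanSpace.norm_sq_eq, EuclideanSpace.norm_sq_eq, EuclideanSpace.norm_sq_eq,
    Finset.sum_mul_sum, ← Fintype.sum_prod_type' (f := fun x y => _)]
  refine Fintype.sum_equiv (Equiv.prodProdProdComm _ _ _ _) _ _ fun q => ?_
  simp only [bipartiteTensor, norm_mul, mul_pow, Equiv.prodProdProdComm_apply]

end TensorVec

/-! ### Exact state representations. -/

section StateRep

variable {dA dB : ℕ}

theorem kronecker_one_mulVec_apply (M : Matrix (Fin dA) (Fin dA) ℂ) (φ : Fin dA × Fin dB → ℂ)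
    (a : Fin dA) (b : Fin dB) :
    ((M ⊗ₖ (1 : Matrix (Fin dB) (Fin dB) ℂ)) *ᵥ φ) (a, b) = (M *ᵥ fun a' => φ (a', b)) a := by
  simp [Matrix.mulVec, dotProduct, Fintype.sum_prod_type, Matrix.one_apply]

theorem one_kronecker_mulVec_apply (M : Matrix (Fin dB) (Fin dB) ℂ) (φ : Fin dA × Fin dB → ℂ)
    (a : Fin dA) (b : Fin dB) :
    (((1 : Matrix (Fin dA) (Fin dA) ℂ) ⊗ₖ M) *ᵥ φ) (a, b) = (M *ᵥ fun b' => φ (a, b')) b := by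
  simp [Matrix.mulVec, dotProduct, Fintype.sum_prod_type, Matrix.one_apply]

/-- Turns traces against the reduced density matrix into inner products with the bipartite state,
where an extremal value determines the vector. -/
theorem trace_mul_reducedA (M : Matrix (Fin dA) (Fin dA) ℂ)
    (ψ : EuclideanSpace ℂ (Fin dA × Fin dB)) :
    (M * reducedA ψ).trace = inner ℂ ψ
      (Matrix.toEuclideanLin (M ⊗ₖ (1 : Matrix (Fin dB) (Fin dB) ℂ)) ψ) := by
  rw [PiLp.inner_apply, Fintype.sum_prod_type]
  refine Finset.sum_congr rfl fun a _ => ?_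
  have h : ∀ b, (Matrix.toEuclideanLin (M ⊗ₖ (1 : Matrix (Fin dB) (Fin dB) ℂ)) ψ) (a, b) =
      ∑ a', M a a' * ψ (a', b) := fun b => kronecker_one_mulVec_apply M ψ a b
  simp only [h, Matrix.diag_apply, Matrix.mul_apply, reducedA, Matrix.of_apply, RCLike.inner_apply,
    Finset.mul_sum, Finset.sum_mul]
  rw [Finset.sum_comm]
  exact Finset.sum_congr rfl fun b _ => Finset.sum_congr rfl fun a' _ => by
    rw [← mul_assoc]; rfl

theorem trace_mul_reducedB (M : Matrix (Fin dB) (Fin dB) ℂ)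
    (ψ : EuclideanSpace ℂ (Fin dA × Fin dB)) :
    (M * reducedB ψ).trace = inner ℂ ψ
      (Matrix.toEuclideanLin ((1 : Matrix (Fin dA) (Fin dA) ℂ) ⊗ₖ M) ψ) := by
  rw [PiLp.inner_apply, Fintype.sum_prod_type, Finset.sum_comm]
  refine Finset.sum_congr rfl fun b _ => ?_
  have h : ∀ a, (Matrix.toEuclideanLin ((1 : Matrix (Fin dA) (Fin dA) ℂ) ⊗ₖ M) ψ) (a, b) =
      ∑ b', M b b' * ψ (a, b') := fun a => one_kronecker_mulVec_apply M ψ a b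
  simp only [h, Matrix.diag_apply, Matrix.mul_apply, reducedB, Matrix.of_apply, RCLike.inner_apply,
    Finset.mul_sum, Finset.sum_mul]
  rw [Finset.sum_comm]
  exact Finset.sum_congr rfl fun a _ => Finset.sum_congr rfl fun b' _ => by
    rw [← mul_assoc]; rfl

/-- For unit vectors, `‖x - y‖² = 2 - 2 Re⟨x, y⟩`. -/
theorem eq_of_re_inner_eq_one {E : Type*} [NormedAddCommGroup E] [InnerProductSpace ℂ E] {x y : E}
    (hx : ‖x‖ = 1) (hy : ‖y‖ = 1) (h : (inner ℂ x y).re = 1) : y = x := by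
  have h1 := @norm_sub_sq ℂ _ _ _ _ x y
  have h2 : RCLike.re (inner ℂ x y) = 1 := h
  rw [hx, hy, h2] at h1
  have h3 : ‖x - y‖ = 0 := by
    have : ‖x - y‖ ^ 2 = 0 := by rw [h1]; norm_num
    exact pow_eq_zero_iff (two_ne_zero) |>.1 this
  exact (sub_eq_zero.1 (norm_eq_zero.1 h3)).symm

/-- For an exact state representation, words representing the identity fix the state. -/
theorem InducesStateRep.map_eq_of_lift_eq_one {G I Y : Type*} [Group G] [Fintype G] [Fintype Y]
    {d : ℕ} {P : I → G} (hP : Function.Surjective (FreeGroup.lift P))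
    {A : I → Matrix.unitaryGroup (Fin d) ℂ} {τ : Matrix (Fin d) (Fin d) ℂ}
    (h : InducesStateRep P A τ) {ψ : EuclideanSpace ℂ Y} (hψ : ‖ψ‖ = 1)
    (Φ : Matrix (Fin d) (Fin d) ℂ → EuclideanSpace ℂ Y)
    (hΦ : ∀ M, Mᴴ * M = 1 → ‖Φ M‖ = 1) (hτ : ∀ M, (M * τ).trace = inner ℂ ψ (Φ M))
    {x : FreeGroup I} (hx : FreeGroup.lift P x = 1) :
    Φ (FreeGroup.lift A x : Matrix (Fin d) (Fin d) ℂ) = ψ := by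
  classical
  -- The choice of words is arbitrary, so the given `x` may represent the identity.
  let s : G → FreeGroup I := Function.update (Function.surjInv hP) 1 x
  have hs1 : s 1 = x := Function.update_self _ _ _
  have hs : ∀ g, FreeGroup.lift P (s g) = g := by
    intro g
    by_cases hg : g = 1
    · rw [hg, hs1, hx]
    · simp only [s, Function.update_of_ne hg]
      exact Function.surjInv_eq hP g
  have h1 := h s hs
  let t : G → G → ℝ := fun x y =>
    (((FreeGroup.lift A (s x) : Matrix (Fin d) (Fin d) ℂ)ᴴ *
      (FreeGroup.lift A (s y) : Matrix (Fin d) (Fin d) ℂ))ᴴ *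
      (FreeGroup.lift A (s (x⁻¹ * y)) : Matrix (Fin d) (Fin d) ℂ) * τ).trace.re
  have hu : ∀ x y, ∃ U : Matrix.unitaryGroup (Fin d) ℂ,
      ((FreeGroup.lift A (s x) : Matrix (Fin d) (Fin d) ℂ)ᴴ *
      (FreeGroup.lift A (s y) : Matrix (Fin d) (Fin d) ℂ))ᴴ *
      (FreeGroup.lift A (s (x⁻¹ * y)) : Matrix (Fin d) (Fin d) ℂ) = U := fun x y =>
    ⟨star (star (FreeGroup.lift A (s x)) * FreeGroup.lift A (s y)) *
      FreeGroup.lift A (s (x⁻¹ * y)), rfl⟩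
  have ht : ∀ x y, t x y ≤ 1 := by
    intro x y
    obtain ⟨U, hU⟩ := hu x y
    simp only [t]
    rw [hU, hτ]
    refine (Complex.re_le_norm _).trans ((norm_inner_le_norm _ _).trans ?_)
    rw [hψ, hΦ _ (unitary_conjTranspose_mul_self U), mul_one]
  have h2 : 1 ≤ 1 / (Fintype.card G : ℝ) ^ 2 * ∑ x, ∑ y, t x y := by
    simpa [IsApproxStateRep, t] using h1
  have hc : (0 : ℝ) < (Fintype.card G : ℝ) ^ 2 := by
    have : 0 < Fintype.card G := Fintype.card_pos
    positivity
  rw [one_div, ← div_eq_inv_mul, le_div_iff₀ hc, one_mul] at h2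
  have h3 : ∑ x : G, ∑ y : G, (1 : ℝ) = (Fintype.card G : ℝ) ^ 2 := by simp [sq]
  have h4 : ∑ x, ∑ y, t x y = ∑ x : G, ∑ y : G, (1 : ℝ) :=
    -- The average of the terms is at least 1 and each term is at most 1, so all are equal to 1.
    le_antisymm (Finset.sum_le_sum fun x _ => Finset.sum_le_sum fun y _ => ht x y) (h3 ▸ h2)
  have h5 := (Finset.sum_eq_sum_iff_of_le fun x _ => Finset.sum_le_sum fun y _ => ht x y).1 h4 1
    (Finset.mem_univ _)
  have h6 := (Finset.sum_eq_sum_iff_of_le fun y _ => ht 1 y).1 h5 1 (Finset.mem_univ _)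
  -- At the pair `(1, 1)` the product of the first two factors cancels, which leaves the expectation
  -- of the single word `x`.
  simp only [t, inv_one, mul_one, hs1, unitary_conjTranspose_mul_self, Matrix.conjTranspose_one,
    Matrix.one_mul, hτ] at h6
  exact eq_of_re_inner_eq_one hψ (hΦ _ (unitary_conjTranspose_mul_self _)) h6

end StateRep

/-! ### Descent of irreducible representations to a quotient group. -/

section Descent

/-- An irreducible representation with a nonzero vector fixed by the kernel of `π` descends
along `π`. -/
theorem exists_descent {F G : Type*} [Group F] [Group G] {π : F →* G}
    (hπ : Function.Surjective π) {n : ℕ} {R : F →* Matrix.unitaryGroup (Fin n) ℂ}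
    (hR : (matRep R).IsIrreducible) {v : Fin n → ℂ} (hv : v ≠ 0)
    (hfix : ∀ x, π x = 1 → (R x : Matrix (Fin n) (Fin n) ℂ) *ᵥ v = v) :
    ∃ ρ : G →* Matrix.unitaryGroup (Fin n) ℂ,
      (∀ x, ρ (π x) = R x) ∧ (matRep ρ).IsIrreducible := by
  -- The vectors fixed by the kernel of `π`. The kernel is normal, so `W` is invariant; it contains
  -- `v ≠ 0`, so it is everything by irreducibility.
  let W : Submodule ℂ (Fin n → ℂ) :=
    { carrier := {v | ∀ x, π x = 1 → (R x : Matrix (Fin n) (Fin n) ℂ) *ᵥ v = v}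
      add_mem' := fun {a b} ha hb x hx => by rw [Matrix.mulVec_add, ha x hx, hb x hx]
      zero_mem' := fun x _ => Matrix.mulVec_zero _
      smul_mem' := fun c a ha x hx => by rw [Matrix.mulVec_smul, ha x hx] }
  have hW : W = ⊤ := by
    refine ((isIrreducible_matRep_iff.1 hR).2 W fun g u hu x hx => ?_).resolve_left ?_
    · have h1 := hu (g⁻¹ * x * g) (by simp [hx])
      have h2 : x * g = g * (g⁻¹ * x * g) := by group
      rw [Matrix.mulVec_mulVec, ← Submonoid.coe_mul, ← map_mul, h2, map_mul, Submonoid.coe_mul,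
        ← Matrix.mulVec_mulVec, h1]
    · intro h
      have : v ∈ W := hfix
      rw [h, Submodule.mem_bot] at this
      exact hv this
  have hker : π.ker ≤ R.ker := by
    intro x hx
    refine Subtype.ext (Matrix.toLin'.injective (LinearMap.ext fun u => ?_))
    have : u ∈ W := hW ▸ Submodule.mem_top
    rw [Matrix.toLin'_apply, Matrix.toLin'_apply, this x hx]
    exact (Matrix.one_mulVec u).symm
  have hρ : ∀ x, (π.liftOfSurjective hπ ⟨R, hker⟩) (π x) = R x := fun x =>
    π.liftOfRightInverse_comp_apply _ _ ⟨R, hker⟩ x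
  refine ⟨π.liftOfSurjective hπ ⟨R, hker⟩, hρ, ?_⟩
  obtain ⟨hn, h⟩ := isIrreducible_matRep_iff.1 hR
  refine isIrreducible_matRep_iff.2 ⟨hn, fun W hW => h W fun x u hu => ?_⟩
  rw [← hρ]
  exact hW _ u hu

end Descent

/-! ### Assembling equivalent blocks into a tensor factor. -/

section Blocks

variable {d e : ℕ} {κ : Type*}

/-- The matrix whose blocks of columns are the matrices `w k`. -/
def blockRow (w : κ → Matrix (Fin d) (Fin e) ℂ) : Matrix (Fin d) (κ × Fin e) ℂ :=
  Matrix.of fun a p => w p.1 a p.2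

theorem blockRow_isometry [DecidableEq κ] {w : κ → Matrix (Fin d) (Fin e) ℂ}
    (h1 : ∀ k, (w k)ᴴ * w k = 1) (h2 : ∀ k l, k ≠ l → (w k)ᴴ * w l = 0) :
    (blockRow w)ᴴ * blockRow w = 1 := by
  ext ⟨k, s⟩ ⟨l, t⟩
  have h : ((blockRow w)ᴴ * blockRow w) (k, s) (l, t) = ((w k)ᴴ * w l) s t := rfl
  rw [h]
  by_cases hkl : k = l
  · subst hkl
    rw [h1]
    simp [Matrix.one_apply]
  · rw [h2 k l hkl]
    simp [hkl]

/-- Blocks that carry the same representation assemble into a multiplicity space tensored with that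
representation. -/
theorem mul_blockRow [Fintype κ] [DecidableEq κ] {w : κ → Matrix (Fin d) (Fin e) ℂ}
    {X : Matrix (Fin d) (Fin d) ℂ} {Y : Matrix (Fin e) (Fin e) ℂ} (h : ∀ k, X * w k = w k * Y) :
    X * blockRow w = blockRow w * ((1 : Matrix κ κ ℂ) ⊗ₖ Y) := by
  ext a ⟨k, s⟩
  have h1 : (X * blockRow w) a (k, s) = (X * w k) a s := rfl
  rw [h1, h]
  simp [Matrix.mul_apply, blockRow, Fintype.sum_prod_type, Matrix.one_apply]

/-- Packages a combination of copies of `ψ` as one product vector; the coefficients `c` become the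
state of the multiplicity spaces, from which the junk state is built. -/
theorem kronecker_blockRow_mulVec {d' e' : ℕ} {κ' : Type*} [Fintype κ] [Fintype κ']
    (w : κ → Matrix (Fin d) (Fin e) ℂ) (v : κ' → Matrix (Fin d') (Fin e') ℂ) (c : κ × κ' → ℂ)
    (ψ : Fin e × Fin e' → ℂ) :
    (blockRow w ⊗ₖ blockRow v) *ᵥ tensorVec c ψ =
      ∑ k, ∑ l, c (k, l) • ((w k ⊗ₖ v l) *ᵥ ψ) := by
  ext p
  simp only [Matrix.mulVec, dotProduct, tensorVec, Finset.sum_apply, Pi.smul_apply, smul_eq_mul]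
  rw [← Fintype.sum_prod_type' (f := fun k l => c (k, l) * _)]
  simp only [Finset.mul_sum]
  rw [← Fintype.sum_prod_type' (f := fun x y => _)]
  refine Fintype.sum_equiv (Equiv.prodProdProdComm _ _ _ _) _ _ fun q => ?_
  simp only [Matrix.kroneckerMap_apply, Equiv.prodProdProdComm_apply, blockRow, Matrix.of_apply]
  ring

/-- An isometry out of `ℂ^κ ⊗ ℂ^e` extends to one that is trivial on the second factor. -/
theorem exists_isometry_mul_eq_kronecker_one [Fintype κ] [DecidableEq κ]
    {u : Matrix (Fin d) (κ × Fin e) ℂ}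
    (hu : uᴴ * u = 1) {K : ℕ} (he : 0 < e) (hK : d ≤ K * e) :
    ∃ (V : Matrix (Fin K × Fin e) (Fin d) ℂ) (j : Matrix (Fin K) κ ℂ), Vᴴ * V = 1 ∧
      V * u = j ⊗ₖ (1 : Matrix (Fin e) (Fin e) ℂ) := by
  obtain ⟨a, q, hq, hq'⟩ := exists_complement_isometry u hu
  have ha := trace_complement_isometry hu hq hq'
  rw [Fintype.card_prod, Fintype.card_fin, Fintype.card_fin] at ha
  -- The isometry `u` gives `card κ * e ≤ d ≤ K * e`, and `e` is positive.
  have hκ : Fintype.card κ ≤ Fintype.card (Fin K) := by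
    rw [Fintype.card_fin]
    exact Nat.le_of_mul_le_mul_right (by omega : Fintype.card κ * e ≤ K * e) he
  obtain ⟨f⟩ := Function.Embedding.nonempty_of_card_le hκ
  let j : Matrix (Fin K) κ ℂ := (1 : Matrix (Fin K) (Fin K) ℂ).submatrix id f
  have hj : jᴴ * j = 1 := by
    rw [Matrix.conjTranspose_submatrix, ← Matrix.submatrix_mul _ _ _ id _ Function.bijective_id,
      Matrix.conjTranspose_one, Matrix.mul_one, Matrix.submatrix_one _ f.injective]
  obtain ⟨V, hV, hVu⟩ := exists_isometry_extension u (j ⊗ₖ (1 : Matrix (Fin e) (Fin e) ℂ)) hu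
    (kronecker_isometry hj (by simp)) (by simpa using hK)
  exact ⟨V, j, hV, hVu⟩

end Blocks

/-! ### Passing relations between observables to blocks and components. -/

/-- `U` is a unitary with `X i * U = U * Y i` for all `i`. -/
structure IsUnitaryIntertwiner {I : Type*} {n e : ℕ} (X : I → Matrix.unitaryGroup (Fin n) ℂ)
    (Y : I → Matrix.unitaryGroup (Fin e) ℂ) (U : Matrix (Fin n) (Fin e) ℂ) : Prop where
  isometry : Uᴴ * U = 1
  coisometry : U * Uᴴ = 1
  intertwines : ∀ i, (X i : Matrix (Fin n) (Fin n) ℂ) * U = U * (Y i : Matrix (Fin e) (Fin e) ℂ)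

theorem IsUnitaryIntertwiner.conjTranspose_mul {I : Type*} {n e : ℕ}
    {X : I → Matrix.unitaryGroup (Fin n) ℂ} {Y : I → Matrix.unitaryGroup (Fin e) ℂ}
    {U : Matrix (Fin n) (Fin e) ℂ} (h : IsUnitaryIntertwiner X Y U) (i : I) :
    Uᴴ * (X i : Matrix (Fin n) (Fin n) ℂ) = (Y i : Matrix (Fin e) (Fin e) ℂ) * Uᴴ := by
  rw [← Matrix.mul_one (Uᴴ * _), ← h.coisometry, Matrix.mul_assoc, ← Matrix.mul_assoc _ U,
    h.intertwines, Matrix.mul_assoc, ← Matrix.mul_assoc Uᴴ, h.isometry, Matrix.one_mul]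

/-- The adjoint of the intertwining relation at `g⁻¹`. -/
theorem IrreducibleDecomposition.conjTranspose_mul {F : Type*} [Group F] {d : ℕ}
    {R : F →* Matrix.unitaryGroup (Fin d) ℂ} (D : IrreducibleDecomposition R) (k : D.ι) (g : F) :
    (D.w k)ᴴ * (R g : Matrix (Fin d) (Fin d) ℂ) =
      (D.S k g : Matrix (Fin (D.n k)) (Fin (D.n k)) ℂ) * (D.w k)ᴴ := by
  have := congrArg Matrix.conjTranspose (D.intertwines k g⁻¹)
  simpa only [Matrix.conjTranspose_mul, conjTranspose_coe_map, inv_inv] using this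

theorem IrreducibleDecomposition.pow_eq_one {F : Type*} [Group F] {d : ℕ}
    {R : F →* Matrix.unitaryGroup (Fin d) ℂ} (D : IrreducibleDecomposition R) (k : D.ι) {g : F}
    {n : ℕ} (h : R g ^ n = 1) : D.S k g ^ n = 1 := by
  have h1 := D.conjTranspose_mul k (g ^ n)
  rw [map_pow, map_pow, h] at h1
  refine Subtype.ext ?_
  have h2 := congrArg (fun M => M * D.w k) h1
  simp only [Matrix.mul_assoc, D.isometry, Matrix.mul_one] at h2
  rw [← h2]
  change (D.w k)ᴴ * (1 * D.w k) = 1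
  rw [Matrix.one_mul, D.isometry]

theorem sum_eq_sum_subtype_of_eq_zero {κ M : Type*} [Fintype κ] [AddCommMonoid M] {p : κ → Prop}
    [Fintype {k // p k}] {f : κ → M} (h : ∀ k, ¬ p k → f k = 0) :
    ∑ k, f k = ∑ k : {k // p k}, f k.1 := by
  classical
  rw [← Fintype.sum_subtype_add_sum_subtype p f,
    Finset.sum_eq_zero (s := (Finset.univ : Finset {k // ¬ p k})) fun k _ => h k.1 k.2, add_zero]
  exact Finset.sum_congr (by ext; simp) fun _ _ => rfl

theorem sum_sum_eq_sum_subtype_of_eq_zero {κ κ' M : Type*} [Fintype κ] [Fintype κ']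
    [AddCommMonoid M] {p : κ → Prop} {q : κ' → Prop} [Fintype {k // p k}] [Fintype {l // q l}]
    {f : κ → κ' → M} (h : ∀ k l, ¬ (p k ∧ q l) → f k l = 0) :
    ∑ k, ∑ l, f k l = ∑ k : {k // p k}, ∑ l : {l // q l}, f k.1 l.1 := by
  rw [sum_eq_sum_subtype_of_eq_zero (p := p) fun k hk =>
    Finset.sum_eq_zero fun l _ => h k l fun h' => hk h'.1]
  exact Finset.sum_congr rfl fun k _ =>
    sum_eq_sum_subtype_of_eq_zero fun l hl => h k.1 l fun h' => hl h'.2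

/-- Carries the relations that hold on the whole state over to its components: the operators `N` and
`X` act on different parties. -/
theorem kronecker_one_fixed {dA dB n m : ℕ} {M : Matrix (Fin n) (Fin dA) ℂ}
    (N : Matrix (Fin m) (Fin dB) ℂ) {X : Matrix (Fin dA) (Fin dA) ℂ} {Y : Matrix (Fin n) (Fin n) ℂ}
    (h : M * X = Y * M) {ψ : EuclideanSpace ℂ (Fin dA × Fin dB)}
    (hψ : Matrix.toEuclideanLin (X ⊗ₖ (1 : Matrix (Fin dB) (Fin dB) ℂ)) ψ = ψ) :
    Matrix.toEuclideanLin (Y ⊗ₖ (1 : Matrix (Fin m) (Fin m) ℂ))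
      (Matrix.toEuclideanLin (M ⊗ₖ N) ψ) = Matrix.toEuclideanLin (M ⊗ₖ N) ψ := by
  conv_rhs => rw [← hψ]
  rw [← toEuclideanLin_mul_apply, ← toEuclideanLin_mul_apply, ← Matrix.mul_kronecker_mul,
    ← Matrix.mul_kronecker_mul, h, Matrix.one_mul, Matrix.mul_one]

theorem one_kronecker_fixed {dA dB n m : ℕ} (M : Matrix (Fin n) (Fin dA) ℂ)
    {N : Matrix (Fin m) (Fin dB) ℂ} {X : Matrix (Fin dB) (Fin dB) ℂ} {Y : Matrix (Fin m) (Fin m) ℂ}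
    (h : N * X = Y * N) {ψ : EuclideanSpace ℂ (Fin dA × Fin dB)}
    (hψ : Matrix.toEuclideanLin ((1 : Matrix (Fin dA) (Fin dA) ℂ) ⊗ₖ X) ψ = ψ) :
    Matrix.toEuclideanLin ((1 : Matrix (Fin n) (Fin n) ℂ) ⊗ₖ Y)
      (Matrix.toEuclideanLin (M ⊗ₖ N) ψ) = Matrix.toEuclideanLin (M ⊗ₖ N) ψ := by
  conv_rhs => rw [← hψ]
  rw [← toEuclideanLin_mul_apply, ← toEuclideanLin_mul_apply, ← Matrix.mul_kronecker_mul,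
    ← Matrix.mul_kronecker_mul, h, Matrix.one_mul, Matrix.mul_one]

/-! ### Rigidity of optimal strategies. -/

section Rigidity

variable {IA IB : Type*} [Fintype IA] [Fintype IB] {nA nB : ℕ}
  {𝒢 : NonlocalGame IA IB nA nB}
  {GA GB : Type*} [Group GA] [Group GB] {P : IA → GA} {Q : IB → GB}
  {dρ dσ : ℕ} {ρbar : GA →* Matrix.unitaryGroup (Fin dρ) ℂ}
  {σbar : GB →* Matrix.unitaryGroup (Fin dσ) ℂ}

/-- On a pair of copies of the optimal representations, an optimal vector is a multiple of the
optimal state. -/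
theorem NonlocalGame.exists_eq_smul_of_isUnitaryIntertwiner
    (hρ : GivesObservables nA P ρbar) (hσ : GivesObservables nB Q σbar)
    {ψ : EuclideanSpace ℂ (Fin dρ × Fin dσ)}
    (hψ_uniq : ∀ (φ : EuclideanSpace ℂ (Fin dρ × Fin dσ)) (hφ : ‖φ‖ = 1),
      𝒢.IsOptimal (repStrategy hρ hσ φ hφ) → ∃ c : ℂ, ‖c‖ = 1 ∧ φ = c • ψ)
    {n m : ℕ} {X : IA → Matrix.unitaryGroup (Fin n) ℂ} {Y : IB → Matrix.unitaryGroup (Fin m) ℂ}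
    {U : Matrix (Fin n) (Fin dρ) ℂ} {V : Matrix (Fin m) (Fin dσ) ℂ}
    (hU : IsUnitaryIntertwiner X (fun i => ρbar (P i)) U)
    (hV : IsUnitaryIntertwiner Y (fun j => σbar (Q j)) V)
    {φ : EuclideanSpace ℂ (Fin n × Fin m)}
    (hval : 𝒢.winForm (fun i => (X i : Matrix (Fin n) (Fin n) ℂ))
      (fun j => (Y j : Matrix (Fin m) (Fin m) ℂ)) φ = 𝒢.quantumValue * ‖φ‖ ^ 2) :
    ∃ c : ℂ, φ = c • Matrix.toEuclideanLin (U ⊗ₖ V) ψ := by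
  -- Pull `φ` back along the unitaries: its norm and winning form are preserved, and uniqueness of
  -- the optimal state applies after normalization.
  have h1 : Matrix.toEuclideanLin (U ⊗ₖ V) (Matrix.toEuclideanLin (Uᴴ ⊗ₖ Vᴴ) φ) = φ := by
    rw [← toEuclideanLin_mul_apply, ← Matrix.mul_kronecker_mul, hU.coisometry, hV.coisometry,
      Matrix.one_kronecker_one, toEuclideanLin_one_apply]
  have h2 : ‖Matrix.toEuclideanLin (Uᴴ ⊗ₖ Vᴴ) φ‖ = ‖φ‖ :=
    norm_toEuclideanLin_of_isometry (kronecker_isometry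
      (by rw [Matrix.conjTranspose_conjTranspose, hU.coisometry])
      (by rw [Matrix.conjTranspose_conjTranspose, hV.coisometry])) φ
  have h3 := winForm_toEuclideanLin (𝒢 := 𝒢) hU.conjTranspose_mul hV.conjTranspose_mul φ
  rw [Matrix.conjTranspose_conjTranspose, Matrix.conjTranspose_conjTranspose, hU.coisometry,
    hV.coisometry, Matrix.one_kronecker_one, toEuclideanLin_one_apply] at h3
  have h4 := h3.trans hval
  rw [← h2] at h4
  by_cases h0 : Matrix.toEuclideanLin (Uᴴ ⊗ₖ Vᴴ) φ = 0
  · exact ⟨0, by rw [← h1, h0, map_zero, zero_smul]⟩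
  obtain ⟨c, -, hc⟩ := hψ_uniq _ _ (isOptimal_normalize hρ hσ h0 h4)
  refine ⟨(‖Matrix.toEuclideanLin (Uᴴ ⊗ₖ Vᴴ) φ‖ : ℂ) * c, ?_⟩
  have h5 : Matrix.toEuclideanLin (Uᴴ ⊗ₖ Vᴴ) φ =
      ((‖Matrix.toEuclideanLin (Uᴴ ⊗ₖ Vᴴ) φ‖ : ℂ) * c) • ψ := by
    rw [mul_smul, ← hc, smul_smul, Complex.ofReal_inv, mul_inv_cancel₀, one_smul]
    exact_mod_cast norm_ne_zero_iff.2 h0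
  rw [← map_smul, ← h5, h1]

variable [NeZero nA] [NeZero nB]

/-- Links a single optimal vector to the supremum in which the uniqueness of the representations is
stated. -/
theorem NonlocalGame.repValue_eq_of_isOptimal {ρ : GA →* Matrix.unitaryGroup (Fin dρ) ℂ}
    {σ : GB →* Matrix.unitaryGroup (Fin dσ) ℂ}
    (hρ : GivesObservables nA P ρ) (hσ : GivesObservables nB Q σ)
    {φ : EuclideanSpace ℂ (Fin dρ × Fin dσ)} (hφ : ‖φ‖ = 1)
    (h : 𝒢.IsOptimal (repStrategy hρ hσ φ hφ)) : 𝒢.repValue hρ hσ = 𝒢.quantumValue := by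
  have : Nonempty {ψ : EuclideanSpace ℂ (Fin dρ × Fin dσ) // ‖ψ‖ = 1} := ⟨⟨φ, hφ⟩⟩
  refine le_antisymm (ciSup_le fun ψ => value_le_quantumValue _) ?_
  rw [← h]
  refine le_ciSup (f := fun ψ : {ψ : EuclideanSpace ℂ (Fin dρ × Fin dσ) // ‖ψ‖ = 1} =>
    𝒢.value (repStrategy hρ hσ ψ.1 ψ.2)) ⟨𝒢.quantumValue, ?_⟩ ⟨φ, hφ⟩
  rintro _ ⟨ψ, rfl⟩
  exact value_le_quantumValue _

/-- A nonzero optimal component lives on copies of the optimal irreducible representations. -/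
theorem NonlocalGame.exists_isUnitaryIntertwiner
    (hP : Function.Surjective (FreeGroup.lift P)) (hQ : Function.Surjective (FreeGroup.lift Q))
    (hρ_irr : (matRep ρbar).IsIrreducible) (hσ_irr : (matRep σbar).IsIrreducible)
    (huniq : ∀ (d e : ℕ) (ρ : GA →* Matrix.unitaryGroup (Fin d) ℂ)
      (σ : GB →* Matrix.unitaryGroup (Fin e) ℂ),
      (matRep ρ).IsIrreducible → (matRep σ).IsIrreducible →
      ∀ (hρ' : GivesObservables nA P ρ) (hσ' : GivesObservables nB Q σ),
        𝒢.repValue hρ' hσ' = 𝒢.quantumValue →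
        Nonempty ((matRep ρ).Equiv (matRep ρbar)) ∧ Nonempty ((matRep σ).Equiv (matRep σbar)))
    {n m : ℕ} {R : FreeGroup IA →* Matrix.unitaryGroup (Fin n) ℂ}
    {S : FreeGroup IB →* Matrix.unitaryGroup (Fin m) ℂ}
    (hR : (matRep R).IsIrreducible) (hS : (matRep S).IsIrreducible)
    (hRn : ∀ i, R (.of i) ^ nA = 1) (hSn : ∀ j, S (.of j) ^ nB = 1)
    {φ : EuclideanSpace ℂ (Fin n × Fin m)} (hφ : φ ≠ 0)
    (hRφ : ∀ x, FreeGroup.lift P x = 1 → Matrix.toEuclideanLin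
      ((R x : Matrix (Fin n) (Fin n) ℂ) ⊗ₖ (1 : Matrix (Fin m) (Fin m) ℂ)) φ = φ)
    (hSφ : ∀ x, FreeGroup.lift Q x = 1 → Matrix.toEuclideanLin
      ((1 : Matrix (Fin n) (Fin n) ℂ) ⊗ₖ (S x : Matrix (Fin m) (Fin m) ℂ)) φ = φ)
    (hval : 𝒢.winForm (fun i => (R (.of i) : Matrix (Fin n) (Fin n) ℂ))
      (fun j => (S (.of j) : Matrix (Fin m) (Fin m) ℂ)) φ = 𝒢.quantumValue * ‖φ‖ ^ 2) :
    (∃ U, IsUnitaryIntertwiner (fun i => R (.of i)) (fun i => ρbar (P i)) U) ∧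
      ∃ V, IsUnitaryIntertwiner (fun j => S (.of j)) (fun j => σbar (Q j)) V := by
  -- The slices of `φ` through a nonzero entry are nonzero vectors, one for each party, and are
  -- fixed by that party's kernel. They make both representations descend.
  obtain ⟨a, b, hab⟩ : ∃ a b, φ (a, b) ≠ 0 := by
    by_contra! h
    exact hφ (by ext ⟨a, b⟩; exact h a b)
  obtain ⟨ρ, hρR, hρ⟩ := exists_descent hP hR (v := fun a' => φ (a', b))
    (fun h => hab (congrFun h a)) (fun x hx => funext fun a' => by
      have h1 : (((R x : Matrix (Fin n) (Fin n) ℂ) ⊗ₖ (1 : Matrix (Fin m) (Fin m) ℂ)) *ᵥ φ.ofLp)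
        (a', b) = φ (a', b) := congrFun (congrArg WithLp.ofLp (hRφ x hx)) (a', b)
      rwa [kronecker_one_mulVec_apply] at h1)
  obtain ⟨σ, hσS, hσ⟩ := exists_descent hQ hS (v := fun b' => φ (a, b'))
    (fun h => hab (congrFun h b)) (fun x hx => funext fun b' => by
      have h1 : (((1 : Matrix (Fin n) (Fin n) ℂ) ⊗ₖ (S x : Matrix (Fin m) (Fin m) ℂ)) *ᵥ φ.ofLp)
        (a, b') = φ (a, b') := congrFun (congrArg WithLp.ofLp (hSφ x hx)) (a, b')
      rwa [one_kronecker_mulVec_apply] at h1)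
  have hρP : ∀ i, R (.of i) = ρ (P i) := fun i => by rw [← hρR, FreeGroup.lift_apply_of]
  have hσQ : ∀ j, S (.of j) = σ (Q j) := fun j => by rw [← hσS, FreeGroup.lift_apply_of]
  simp only [hρP, hσQ] at hRn hSn hval ⊢
  obtain ⟨⟨f⟩, ⟨g⟩⟩ := huniq n m ρ σ hρ hσ hRn hSn
    (repValue_eq_of_isOptimal hRn hSn (norm_inv_norm_smul hφ)
      (isOptimal_normalize hRn hSn hφ hval))
  obtain ⟨U, hU, hU', hUi⟩ := exists_unitary_intertwiner hρ_irr f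
  obtain ⟨V, hV, hV', hVi⟩ := exists_unitary_intertwiner hσ_irr g
  exact ⟨⟨U, hU, hU', fun i => hUi _⟩, ⟨V, hV, hV', fun j => hVi _⟩⟩

/-- The blocks of a decomposition that are unitarily equivalent to `Y`. -/
abbrev IrreducibleDecomposition.Matching {I : Type*} {d e : ℕ}
    {R : FreeGroup I →* Matrix.unitaryGroup (Fin d) ℂ} (D : IrreducibleDecomposition R)
    (Y : I → Matrix.unitaryGroup (Fin e) ℂ) : Type :=
  {k : D.ι // ∃ U, IsUnitaryIntertwiner (fun i => D.S k (.of i)) Y U}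

noncomputable instance {I : Type*} {d e : ℕ}
    {R : FreeGroup I →* Matrix.unitaryGroup (Fin d) ℂ} (D : IrreducibleDecomposition R)
    (Y : I → Matrix.unitaryGroup (Fin e) ℂ) : Fintype (D.Matching Y) :=
  Fintype.ofFinite _

/-- The isometric embedding of a matching block. -/
noncomputable def IrreducibleDecomposition.embed {I : Type*} {d e : ℕ}
    {R : FreeGroup I →* Matrix.unitaryGroup (Fin d) ℂ} (D : IrreducibleDecomposition R)
    (Y : I → Matrix.unitaryGroup (Fin e) ℂ) (k : D.Matching Y) : Matrix (Fin d) (Fin e) ℂ :=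
  D.w k.1 * k.2.choose

section Embed

variable {I : Type*} {d e : ℕ} {R : FreeGroup I →* Matrix.unitaryGroup (Fin d) ℂ}
  (D : IrreducibleDecomposition R) (Y : I → Matrix.unitaryGroup (Fin e) ℂ)

theorem IrreducibleDecomposition.embed_isometry (k : D.Matching Y) :
    (D.embed Y k)ᴴ * D.embed Y k = 1 := by
  rw [IrreducibleDecomposition.embed, Matrix.conjTranspose_mul, Matrix.mul_assoc,
    ← Matrix.mul_assoc (D.w k.1)ᴴ, D.isometry, Matrix.one_mul, k.2.choose_spec.isometry]

theorem IrreducibleDecomposition.embed_orthogonal (k l : D.Matching Y) (hkl : k ≠ l) :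
    (D.embed Y k)ᴴ * D.embed Y l = 0 := by
  rw [IrreducibleDecomposition.embed, Matrix.conjTranspose_mul, Matrix.mul_assoc,
    IrreducibleDecomposition.embed, ← Matrix.mul_assoc (D.w k.1)ᴴ,
    D.orthogonal _ _ (fun h => hkl (Subtype.ext h)), Matrix.zero_mul, Matrix.mul_zero]

theorem IrreducibleDecomposition.mul_embed (k : D.Matching Y) (i : I) :
    (R (.of i) : Matrix (Fin d) (Fin d) ℂ) * D.embed Y k =
      D.embed Y k * (Y i : Matrix (Fin e) (Fin e) ℂ) := by
  rw [IrreducibleDecomposition.embed, ← Matrix.mul_assoc, D.intertwines, Matrix.mul_assoc,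
    k.2.choose_spec.intertwines, Matrix.mul_assoc]

end Embed

/-- An optimal strategy inducing state representations is, on its state, a sum of copies of the
optimal one. -/
theorem NonlocalGame.exists_blocks [Fintype GA] [Fintype GB]
    (hP : Function.Surjective (FreeGroup.lift P)) (hQ : Function.Surjective (FreeGroup.lift Q))
    (hρ_irr : (matRep ρbar).IsIrreducible) (hσ_irr : (matRep σbar).IsIrreducible)
    (hρ : GivesObservables nA P ρbar) (hσ : GivesObservables nB Q σbar)
    (huniq : ∀ (d e : ℕ) (ρ : GA →* Matrix.unitaryGroup (Fin d) ℂ)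
      (σ : GB →* Matrix.unitaryGroup (Fin e) ℂ),
      (matRep ρ).IsIrreducible → (matRep σ).IsIrreducible →
      ∀ (hρ' : GivesObservables nA P ρ) (hσ' : GivesObservables nB Q σ),
        𝒢.repValue hρ' hσ' = 𝒢.quantumValue →
        Nonempty ((matRep ρ).Equiv (matRep ρbar)) ∧ Nonempty ((matRep σ).Equiv (matRep σbar)))
    {ψ : EuclideanSpace ℂ (Fin dρ × Fin dσ)}
    (hψ_uniq : ∀ (φ : EuclideanSpace ℂ (Fin dρ × Fin dσ)) (hφ : ‖φ‖ = 1),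
      𝒢.IsOptimal (repStrategy hρ hσ φ hφ) → ∃ c : ℂ, ‖c‖ = 1 ∧ φ = c • ψ)
    {dA dB : ℕ} {T : QStrategy IA IB nA nB dA dB} (hT : 𝒢.IsOptimal T)
    (hTA : InducesStateRep P T.A (reducedA T.ψ)) (hTB : InducesStateRep Q T.B (reducedB T.ψ))
    (D : IrreducibleDecomposition (FreeGroup.lift T.A))
    (E : IrreducibleDecomposition (FreeGroup.lift T.B)) :
    ∃ c : D.Matching (fun i => ρbar (P i)) × E.Matching (fun j => σbar (Q j)) → ℂ,
      WithLp.ofLp T.ψ = (blockRow (D.embed fun i => ρbar (P i)) ⊗ₖ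
        blockRow (E.embed fun j => σbar (Q j))) *ᵥ tensorVec c ψ.ofLp := by
  classical
  have hfixA : ∀ x, FreeGroup.lift P x = 1 → Matrix.toEuclideanLin
      ((FreeGroup.lift T.A x : Matrix (Fin dA) (Fin dA) ℂ) ⊗ₖ (1 : Matrix (Fin dB) (Fin dB) ℂ))
        T.ψ = T.ψ := fun x hx =>
    hTA.map_eq_of_lift_eq_one hP T.norm_ψ
      (fun M => Matrix.toEuclideanLin (M ⊗ₖ (1 : Matrix (Fin dB) (Fin dB) ℂ)) T.ψ)
      (fun M hM => by
        rw [norm_toEuclideanLin_of_isometry (kronecker_isometry hM (by simp)), T.norm_ψ])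
      (fun M => trace_mul_reducedA M T.ψ) hx
  have hfixB : ∀ x, FreeGroup.lift Q x = 1 → Matrix.toEuclideanLin
      ((1 : Matrix (Fin dA) (Fin dA) ℂ) ⊗ₖ (FreeGroup.lift T.B x : Matrix (Fin dB) (Fin dB) ℂ))
        T.ψ = T.ψ := fun x hx =>
    hTB.map_eq_of_lift_eq_one hQ T.norm_ψ
      (fun M => Matrix.toEuclideanLin ((1 : Matrix (Fin dA) (Fin dA) ℂ) ⊗ₖ M) T.ψ)
      (fun M hM => by
        rw [norm_toEuclideanLin_of_isometry (kronecker_isometry (by simp) hM), T.norm_ψ])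
      (fun M => trace_mul_reducedB M T.ψ) hx
  have hDn : ∀ k i, D.S k (.of i) ^ nA = 1 := fun k i =>
    D.pow_eq_one k (by rw [FreeGroup.lift_apply_of, T.A_pow])
  have hEn : ∀ l j, E.S l (.of j) ^ nB = 1 := fun l j =>
    E.pow_eq_one l (by rw [FreeGroup.lift_apply_of, T.B_pow])
  let Φ : ∀ k l, EuclideanSpace ℂ (Fin (D.n k) × Fin (E.n l)) := fun k l =>
    Matrix.toEuclideanLin ((D.w k)ᴴ ⊗ₖ (E.w l)ᴴ) T.ψ
  have hval : ∀ k l, 𝒢.winForm (fun i => (D.S k (.of i) : Matrix (Fin (D.n k)) (Fin (D.n k)) ℂ))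
      (fun j => (E.S l (.of j) : Matrix (Fin (E.n l)) (Fin (E.n l)) ℂ)) (Φ k l) =
      𝒢.quantumValue * ‖Φ k l‖ ^ 2 := fun k l =>
    winForm_component_eq hT (R := fun k i => D.S k (.of i)) (S := fun l j => E.S l (.of j)) hDn hEn
      (fun k i => by rw [← D.conjTranspose_mul, FreeGroup.lift_apply_of])
      (fun l j => by rw [← E.conjTranspose_mul, FreeGroup.lift_apply_of])
      D.sum_eq_one E.sum_eq_one k l
  have hmatch : ∀ k l, Φ k l ≠ 0 →
      (∃ U, IsUnitaryIntertwiner (fun i => D.S k (.of i)) (fun i => ρbar (P i)) U) ∧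
      ∃ V, IsUnitaryIntertwiner (fun j => E.S l (.of j)) (fun j => σbar (Q j)) V := by
    intro k l h0
    exact exists_isUnitaryIntertwiner hP hQ hρ_irr hσ_irr huniq (D.irreducible k)
      (E.irreducible l) (hDn k) (hEn l) h0
      (fun x hx => kronecker_one_fixed _ (D.conjTranspose_mul k x) (hfixA x hx))
      (fun x hx => one_kronecker_fixed _ (E.conjTranspose_mul l x) (hfixB x hx)) (hval k l)
  -- This covers every pair of matching blocks, also those with zero component, where the
  -- coefficient may be taken to be 0.
  have hc : ∀ (k : D.Matching (fun i => ρbar (P i))) (l : E.Matching (fun j => σbar (Q j))),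
      ∃ c : ℂ, Φ k.1 l.1 = c • Matrix.toEuclideanLin (k.2.choose ⊗ₖ l.2.choose) ψ :=
    fun k l => exists_eq_smul_of_isUnitaryIntertwiner hρ hσ hψ_uniq k.2.choose_spec
      l.2.choose_spec (hval k.1 l.1)
  choose c hc using hc
  refine ⟨fun p => c p.1 p.2, ?_⟩
  rw [kronecker_blockRow_mulVec]
  -- The sum over all pairs of blocks therefore reduces to the matching ones.
  have hzero : ∀ k l, ¬ ((∃ U, IsUnitaryIntertwiner (fun i => D.S k (.of i))
      (fun i => ρbar (P i)) U) ∧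
      ∃ V, IsUnitaryIntertwiner (fun j => E.S l (.of j)) (fun j => σbar (Q j)) V) → Φ k l = 0 :=
    fun k l h => by_contra fun h0 => h (hmatch k l h0)
  calc WithLp.ofLp T.ψ =
      WithLp.ofLp (∑ k, ∑ l, Matrix.toEuclideanLin (D.w k ⊗ₖ E.w l) (Φ k l)) := by
        rw [sum_toEuclideanLin_components D.sum_eq_one E.sum_eq_one T.ψ]
    _ = WithLp.ofLp (∑ k : D.Matching (fun i => ρbar (P i)),
        ∑ l : E.Matching (fun j => σbar (Q j)),
          Matrix.toEuclideanLin (D.w k.1 ⊗ₖ E.w l.1) (Φ k.1 l.1)) := by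
        refine congrArg WithLp.ofLp (sum_sum_eq_sum_subtype_of_eq_zero
          (f := fun k l => Matrix.toEuclideanLin (D.w k ⊗ₖ E.w l) (Φ k l)) fun k l h => ?_)
        simp only [hzero k l h, map_zero]
    _ = _ := by
        simp only [hc, map_smul, WithLp.ofLp_sum, WithLp.ofLp_smul]
        refine Finset.sum_congr rfl fun k _ => Finset.sum_congr rfl fun l _ => ?_
        rw [← toEuclideanLin_mul_apply, ← Matrix.mul_kronecker_mul]
        rfl

end Rigidity

/-! ### The theorem. -/

theorem mainTheorem3 {IA IB : Type*} [Fintype IA] [Fintype IB] {nA nB : ℕ} [NeZero nA] [NeZero nB]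
    (𝒢 : NonlocalGame IA IB nA nB)
    {GA GB : Type*} [Group GA] [Fintype GA] [Group GB] [Fintype GB]
    (P : IA → GA) (Q : IB → GB)
    (hP : Subgroup.closure (Set.range P) = ⊤) (hQ : Subgroup.closure (Set.range Q) = ⊤)
    -- the irreps attaining the quantum value
    {dρ dσ : ℕ} (ρbar : GA →* Matrix.unitaryGroup (Fin dρ) ℂ)
    (σbar : GB →* Matrix.unitaryGroup (Fin dσ) ℂ)
    (hρ_irr : (matRep ρbar).IsIrreducible) (hσ_irr : (matRep σbar).IsIrreducible)
    (hρ : GivesObservables nA P ρbar) (hσ : GivesObservables nB Q σbar)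
    (hval : 𝒢.repValue hρ hσ = 𝒢.quantumValue)
    -- they are the only such pair, up to equivalence
    (huniq : ∀ (d e : ℕ) (ρ : GA →* Matrix.unitaryGroup (Fin d) ℂ)
      (σ : GB →* Matrix.unitaryGroup (Fin e) ℂ),
      (matRep ρ).IsIrreducible → (matRep σ).IsIrreducible →
      ∀ (hρ' : GivesObservables nA P ρ) (hσ' : GivesObservables nB Q σ),
        𝒢.repValue hρ' hσ' = 𝒢.quantumValue →
        Nonempty ((matRep ρ).Equiv (matRep ρbar)) ∧ Nonempty ((matRep σ).Equiv (matRep σbar)))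
    -- the unique optimal state, up to a global phase
    (ψ : EuclideanSpace ℂ (Fin dρ × Fin dσ)) (hψ : ‖ψ‖ = 1)
    (hopt : 𝒢.IsOptimal (repStrategy hρ hσ ψ hψ))
    (hψ_uniq : ∀ (φ : EuclideanSpace ℂ (Fin dρ × Fin dσ)) (hφ : ‖φ‖ = 1),
      𝒢.IsOptimal (repStrategy hρ hσ φ hφ) → ∃ c : ℂ, ‖c‖ = 1 ∧ φ = c • ψ) :
    (∀ (dA dB : ℕ) (S : QStrategy IA IB nA nB dA dB), 𝒢.IsOptimal S →
      InducesStateRep P S.A (reducedA S.ψ) → InducesStateRep Q S.B (reducedB S.ψ) →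
      ∃ kA kB : ℕ, kA * dρ = dA * Fintype.card GA ∧ kB * dσ = dB * Fintype.card GB ∧
        ∃ (VA : Matrix (Fin kA × Fin dρ) (Fin dA) ℂ) (VB : Matrix (Fin kB × Fin dσ) (Fin dB) ℂ)
          (junk : EuclideanSpace ℂ (Fin kA × Fin kB)),
          VAᴴ * VA = 1 ∧ VBᴴ * VB = 1 ∧ ‖junk‖ = 1 ∧
          Matrix.toEuclideanLin (VA ⊗ₖ VB) S.ψ = bipartiteTensor junk ψ ∧
          (∀ i, Matrix.toEuclideanLin
              ((VA * (S.A i : Matrix (Fin dA) (Fin dA) ℂ)) ⊗ₖ VB) S.ψ =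
            bipartiteTensor junk (Matrix.toEuclideanLin
              ((ρbar (P i) : Matrix (Fin dρ) (Fin dρ) ℂ) ⊗ₖ
                (1 : Matrix (Fin dσ) (Fin dσ) ℂ)) ψ)) ∧
          (∀ j, Matrix.toEuclideanLin
              (VA ⊗ₖ (VB * (S.B j : Matrix (Fin dB) (Fin dB) ℂ))) S.ψ =
            bipartiteTensor junk (Matrix.toEuclideanLin
              ((1 : Matrix (Fin dρ) (Fin dρ) ℂ) ⊗ₖ
                (σbar (Q j) : Matrix (Fin dσ) (Fin dσ) ℂ)) ψ))) ∧
    ((∀ (dA dB : ℕ) (S : QStrategy IA IB nA nB dA dB), 𝒢.IsOptimal S →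
        InducesStateRep P S.A (reducedA S.ψ) ∧ InducesStateRep Q S.B (reducedB S.ψ)) →
      𝒢.IsSelfTest (repStrategy hρ hσ ψ hψ)) := by
  classical
  have hP' := FreeGroup.lift_surjective_iff_closure_range_eq_top.2 hP
  have hQ' := FreeGroup.lift_surjective_iff_closure_range_eq_top.2 hQ
  have hdρ := dim_pos_of_isIrreducible hρ_irr
  have hdσ := dim_pos_of_isIrreducible hσ_irr
  obtain ⟨rA, hrA⟩ := dim_dvd_card hρ_irr
  obtain ⟨rB, hrB⟩ := dim_dvd_card hσ_irr
  have rigid : ∀ (dA dB : ℕ) (S : QStrategy IA IB nA nB dA dB), 𝒢.IsOptimal S →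
      InducesStateRep P S.A (reducedA S.ψ) → InducesStateRep Q S.B (reducedB S.ψ) →
      ∃ kA kB : ℕ, kA * dρ = dA * Fintype.card GA ∧ kB * dσ = dB * Fintype.card GB ∧
        ∃ (VA : Matrix (Fin kA × Fin dρ) (Fin dA) ℂ) (VB : Matrix (Fin kB × Fin dσ) (Fin dB) ℂ)
          (junk : EuclideanSpace ℂ (Fin kA × Fin kB)),
          VAᴴ * VA = 1 ∧ VBᴴ * VB = 1 ∧ ‖junk‖ = 1 ∧
          Matrix.toEuclideanLin (VA ⊗ₖ VB) S.ψ = bipartiteTensor junk ψ ∧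
          (∀ i, Matrix.toEuclideanLin
              ((VA * (S.A i : Matrix (Fin dA) (Fin dA) ℂ)) ⊗ₖ VB) S.ψ =
            bipartiteTensor junk (Matrix.toEuclideanLin
              ((ρbar (P i) : Matrix (Fin dρ) (Fin dρ) ℂ) ⊗ₖ
                (1 : Matrix (Fin dσ) (Fin dσ) ℂ)) ψ)) ∧
          (∀ j, Matrix.toEuclideanLin
              (VA ⊗ₖ (VB * (S.B j : Matrix (Fin dB) (Fin dB) ℂ))) S.ψ =
            bipartiteTensor junk (Matrix.toEuclideanLin
              ((1 : Matrix (Fin dρ) (Fin dρ) ℂ) ⊗ₖ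
                (σbar (Q j) : Matrix (Fin dσ) (Fin dσ) ℂ)) ψ)) := by
    intro dA dB S hS hSA hSB
    obtain ⟨D⟩ := nonempty_irreducibleDecomposition (FreeGroup.lift S.A)
    obtain ⟨E⟩ := nonempty_irreducibleDecomposition (FreeGroup.lift S.B)
    obtain ⟨c, hc⟩ := NonlocalGame.exists_blocks hP' hQ' hρ_irr hσ_irr hρ hσ huniq hψ_uniq hS
      hSA hSB D E
    -- With `rA = |GA| / dρ` the multiplicity space has dimension `dA * rA`, as prescribed. The
    -- isometry fits since `dA ≤ dA * |GA|`.
    have hkA : dA * rA * dρ = dA * Fintype.card GA := by rw [hrA]; ring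
    have hkB : dB * rB * dσ = dB * Fintype.card GB := by rw [hrB]; ring
    obtain ⟨VA, jA, hVA, hVAj⟩ := exists_isometry_mul_eq_kronecker_one
      (blockRow_isometry (D.embed_isometry fun i => ρbar (P i)) (D.embed_orthogonal _)) hdρ
      (K := dA * rA) (by rw [hkA]; exact Nat.le_mul_of_pos_right _ Fintype.card_pos)
    obtain ⟨VB, jB, hVB, hVBj⟩ := exists_isometry_mul_eq_kronecker_one
      (blockRow_isometry (E.embed_isometry fun j => σbar (Q j)) (E.embed_orthogonal _)) hdσ
      (K := dB * rB) (by rw [hkB]; exact Nat.le_mul_of_pos_right _ Fintype.card_pos)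
    have hA : ∀ i, VA * (S.A i : Matrix (Fin dA) (Fin dA) ℂ) *
        blockRow (D.embed fun i => ρbar (P i)) =
        jA ⊗ₖ (ρbar (P i) : Matrix (Fin dρ) (Fin dρ) ℂ) := by
      intro i
      rw [Matrix.mul_assoc, mul_blockRow fun k => ?_, ← Matrix.mul_assoc, hVAj,
        ← Matrix.mul_kronecker_mul, Matrix.mul_one, Matrix.one_mul]
      have := D.mul_embed (fun i => ρbar (P i)) k i
      rwa [FreeGroup.lift_apply_of] at this
    have hB : ∀ j, VB * (S.B j : Matrix (Fin dB) (Fin dB) ℂ) *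
        blockRow (E.embed fun j => σbar (Q j)) =
        jB ⊗ₖ (σbar (Q j) : Matrix (Fin dσ) (Fin dσ) ℂ) := by
      intro j
      rw [Matrix.mul_assoc, mul_blockRow fun k => ?_, ← Matrix.mul_assoc, hVBj,
        ← Matrix.mul_kronecker_mul, Matrix.mul_one, Matrix.one_mul]
      have := E.mul_embed (fun j => σbar (Q j)) k j
      rwa [FreeGroup.lift_apply_of] at this
    -- One identity yields all three equations: `(NA, NB)` will be `(1, 1)`, `(ρbar (P i), 1)` and
    -- `(1, σbar (Q j))`. The junk vector `(jA ⊗ jB) c` does not depend on this choice.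
    have key : ∀ (MA : Matrix (Fin (dA * rA) × Fin dρ) (Fin dA) ℂ)
        (MB : Matrix (Fin (dB * rB) × Fin dσ) (Fin dB) ℂ) (NA : Matrix (Fin dρ) (Fin dρ) ℂ)
        (NB : Matrix (Fin dσ) (Fin dσ) ℂ),
        MA * blockRow (D.embed fun i => ρbar (P i)) = jA ⊗ₖ NA →
        MB * blockRow (E.embed fun j => σbar (Q j)) = jB ⊗ₖ NB →
        Matrix.toEuclideanLin (MA ⊗ₖ MB) S.ψ =
          bipartiteTensor (WithLp.toLp 2 ((jA ⊗ₖ jB) *ᵥ c))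
            (Matrix.toEuclideanLin (NA ⊗ₖ NB) ψ) := by
      intro MA MB NA NB hMA hMB
      apply WithLp.ofLp_injective
      change (MA ⊗ₖ MB) *ᵥ WithLp.ofLp S.ψ =
        tensorVec ((jA ⊗ₖ jB) *ᵥ c) ((NA ⊗ₖ NB) *ᵥ WithLp.ofLp ψ)
      rw [hc, Matrix.mulVec_mulVec, ← Matrix.mul_kronecker_mul, hMA, hMB,
        kronecker_mulVec_tensorVec]
    have h0 : Matrix.toEuclideanLin (VA ⊗ₖ VB) S.ψ =
        bipartiteTensor (WithLp.toLp 2 ((jA ⊗ₖ jB) *ᵥ c)) ψ := by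
      rw [key VA VB 1 1 hVAj hVBj, Matrix.one_kronecker_one, toEuclideanLin_one_apply]
    refine ⟨dA * rA, dB * rB, hkA, hkB, VA, VB, WithLp.toLp 2 ((jA ⊗ₖ jB) *ᵥ c), hVA, hVB, ?_, h0,
      fun i => key _ _ _ _ (hA i) hVBj, fun j => key _ _ _ _ hVAj (hB j)⟩
    -- The junk vector has norm 1 because `VA ⊗ VB` is an isometry and both states are unit vectors.
    have := congrArg norm h0
    rwa [norm_toEuclideanLin_of_isometry (kronecker_isometry hVA hVB), S.norm_ψ,
      norm_bipartiteTensor, hψ, mul_one, eq_comm] at this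
  -- With `ε₀ = 0` only exactly optimal strategies have to be compared, and `rigid` gives distance 0
  -- for them.
  refine ⟨rigid, fun h => ⟨hopt, 0, 0, continuous_const, rfl, fun ε hε eA eB T hT => ?_⟩⟩
  obtain rfl : ε = 0 := nonpos_iff_eq_zero.1 hε
  have hT' : 𝒢.IsOptimal T := le_antisymm (NonlocalGame.value_le_quantumValue T) (by simpa using hT)
  obtain ⟨hTA, hTB⟩ := h eA eB T hT'
  obtain ⟨kA, kB, -, -, VA, VB, junk, hVA, hVB, hj, h1, h2, h3⟩ := rigid eA eB T hT' hTA hTB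
  refine ⟨kA, kB, VA, VB, junk, hVA, hVB, hj, ?_, fun i => ?_, fun j => ?_⟩
  · exact (norm_sub_eq_zero_iff.2 h1).le
  · exact (norm_sub_eq_zero_iff.2 (h2 i)).le
  · exact (norm_sub_eq_zero_iff.2 (h3 j)).le
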